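/- Let $0\le a<1<b\le\infty$ and let $f:(a,b)\to\mathbb{R}$ be convex with $f(1)=0$ and strictly convex on a neighborhood of $1$. Put $f^*(z)=\sup_{t\in(a,b)}\{zt-f(t)\}\in(-\infty,\infty]$ and $z_0=f'_+(1)$, where a subscript $+$ with a prime denotes the right derivative. Let $\alpha<\beta$ be real numbers such that $z_0+\beta-\alpha$ lies in the interior of $\{f^*<\infty\}$. Let $\mathcal{X}$ be a measurable space and let $\Gamma$ be a nonempty set of measurable functions on $\mathcal{X}$ with $\alpha\le h\le\beta$ for all $h\in\Gamma$. Assume that there is a countable $\Gamma_0\subset\Gamma$ such that every $h\in\Gamma$ is the pointwise limit of a sequence in $\Gamma_0$. For probability measures $Q,P$ on $\mathcal{X}$ define $$D_f^\Gamma(Q\|P)=\sup_{h\in\Gamma}\left\{E_Q[h]-\Lambda_f^P[h]\right\},\qquad \Lambda_f^P[h]=\inf_{\nu\in\mathbb{R}}\left\{\nu+E_P[f^*(h-\nu)]\right\}.$$ For an integer $k\ge1$ define $$\mathcal{R}_{\Gamma,P,k}=E_{y\sim P^k}E_\sigma\left[\sup_{h\in\Gamma}\frac1k\sum_{i=1}^k\sigma_i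 h(y_i)\right],$$ where $\sigma$ is uniform on $\{-1,1\}^k$, and $$\Delta_{f,k}=\inf_{z\in[z_0-(\beta-\alpha),z_0]}\left\{k\left(-z+\tfrac{k-1}{k}f^*(z)+\tfrac1k f^*(\beta-\alpha+z)\right)\right\}.$$ Define $\mathcal{K}_{f,\Gamma,P,k}$ as follows. If $\Gamma$ contains a constant function and $(f^*)'_+$ is $L$-Lipschitz on $[z_0-(\beta-\alpha),z_0+\beta-\alpha]$ (for a given constant $L\ge0$), then $$\mathcal{K}_{f,\Gamma,P,k}=\min\left\{(1+2(\beta-\alpha)L)\mathcal{R}_{\Gamma,P,k}+\frac{(\beta-\alpha)^2L}{2k^{1/2}},\ (f^*)'_+(\beta-\alpha+z_0)\left(\mathcal{R}_{\Gamma,P,k}+\frac{\beta-\alpha}{2k^{1/2}}\right)\right\};$$ otherwise $$\mathcal{K}_{f,\Gamma,P,k}=(f^*)'_+(\beta-\alpha+z_0)\left(\mathcal{R}_{\Gamma,P,k}+\frac{\beta-\alpha}{2k^{1/2}}\right).$$ Let $Q,P$ be probability measures on $\mathcal{X}$, let $n,m\ge1$, and let $X_1,\dots,X_n$, $X'_1,\dots,X'_m$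 be jointly independent $\mathcal{X}$-valued random variables, with $X_i\sim Q$ and $X'_i\sim P$, and with empirical measures $Q_n=\frac1n\sum_{i=1}^n\delta_{X_i}$ and $P_m=\frac1m\sum_{i=1}^m\delta_{X'_i}$. Then for every $\epsilon>0$, $$\mathbb{P}\left(D_f^\Gamma(Q\|P)-D_f^\Gamma(Q_n\|P_m)\ge\epsilon\right)\le\exp\left(-\frac{2\epsilon^2}{\frac1n(\beta-\alpha)^2+\frac1m\Delta_{f,m}^2}\right),$$ $$\mathbb{P}\left(D_f^\Gamma(Q_n\|P_m)-D_f^\Gamma(Q\|P)\ge\epsilon+2\mathcal{R}_{\Gamma,Q,n}+2\mathcal{K}_{f,\Gamma,P,m}\right)\le\exp\left(-\frac{2\epsilon^2}{\frac1n(\beta-\alpha)^2+\frac1m\Delta_{f,m}^2}\right).$$ The second bound holds for every choice of $L\ge0$ in the definition of $\mathcal{K}_{f,\Gamma,P,m}$. -/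

import Mathlib

open MeasureTheory ProbabilityTheory Filter Topology Set
open scoped ENNReal NNReal

noncomputable section

namespace FGamma

/-- The real interval `(a, b)` with possibly infinite endpoints. -/
def realIoo (a b : EReal) : Set ℝ := {t : ℝ | a < (t : EReal) ∧ (t : EReal) < b}

/-- The class `𝓕₁(a, b)`: `a < 1 < b`, and `f` is convex on `(a, b)` with `f 1 = 0`.
Values of `f` outside `(a, b)` are irrelevant. -/
structure IsF1 (a b : EReal) (f : ℝ → ℝ) : Prop where
  left_lt_one : a < 1
  one_lt_right : 1 < b
  convexOn : ConvexOn ℝ (realIoo a b) f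
  map_one : f 1 = 0

/-- The Legendre transform `f^*(z) = sup_{t ∈ (a, b)} (z t - f t)`, with values in `[-∞, ∞]`. -/
def conj (a b : EReal) (f : ℝ → ℝ) (z : ℝ) : EReal :=
  ⨆ t ∈ realIoo a b, ((z * t - f t : ℝ) : EReal)

/-- The set `{f^* < ∞}`. -/
def conjDomain (a b : EReal) (f : ℝ → ℝ) : Set ℝ := {z : ℝ | conj a b f z < ⊤}

/-- The real value of `f^*`, meaningful where `f^*` is finite. -/
def conjReal (a b : EReal) (f : ℝ → ℝ) (z : ℝ) : ℝ := (conj a b f z).toReal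

/-- The right derivative `g'_+(x)`. -/
def rightDeriv (g : ℝ → ℝ) (x : ℝ) : ℝ := derivWithin g (Ioi x) x

/-- `z₀ = f'_+(1)`. -/
def zZero (f : ℝ → ℝ) : ℝ := rightDeriv f 1

/-- The expectation of an extended-real function, `E[g⁺] - E[g⁻]`
(meaningful when at least one of the two terms is finite). -/
def extExpect {S : Type*} [MeasurableSpace S] (P : Measure S) (g : S → EReal) : EReal :=
  ((∫⁻ x, (g x).toENNReal ∂P : ℝ≥0∞) : EReal) - ((∫⁻ x, (-(g x)).toENNReal ∂P : ℝ≥0∞) : EReal)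

/-- The generalized cumulant generating function
`Λ_f^P[h] = inf_{ν ∈ ℝ} (ν + E_P[f^*(h - ν)])`. -/
def cumulant {S : Type*} [MeasurableSpace S] (a b : EReal) (f : ℝ → ℝ) (P : Measure S)
    (h : S → ℝ) : EReal :=
  ⨅ ν : ℝ, ((ν : EReal) + extExpect P (fun x => conj a b f (h x - ν)))

/-- The divergence `D_f^Γ(Q‖P) = sup_{h ∈ Γ} (E_Q[h] - Λ_f^P[h])`. -/
def divergence {S : Type*} [MeasurableSpace S] (a b : EReal) (f : ℝ → ℝ) (Γ : Set (S → ℝ))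
    (Q P : Measure S) : EReal :=
  ⨆ h ∈ Γ, (((∫ x, h x ∂Q : ℝ) : EReal) - cumulant a b f P h)

/-- The empirical measure `(1/n) ∑ᵢ δ_{xᵢ}`. -/
def empiricalMeasure {S : Type*} [MeasurableSpace S] {n : ℕ} (x : Fin n → S) : Measure S :=
  (n : ℝ≥0∞)⁻¹ • ∑ i, Measure.dirac (x i)

/-- The empirical Rademacher complexity (without absolute value)
`E_σ[sup_{ψ ∈ Ψ} (1/n) ∑ᵢ σᵢ ψ(yᵢ)]`, with `σ` uniform on `{-1, 1}ⁿ`. -/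
def empRademacher {S : Type*} (Ψ : Set (S → ℝ)) {n : ℕ} (y : Fin n → S) : ℝ :=
  (1 / 2 ^ n : ℝ) * ∑ σ : Fin n → ℤˣ,
    ⨆ ψ : Ψ, (1 / n : ℝ) * ∑ i, (((σ i : ℤˣ) : ℤ) : ℝ) * (ψ : S → ℝ) (y i)

/-- The Rademacher complexity `𝓡_{Ψ,P,n}`, the mean of the empirical one under `Pⁿ`. -/
def rademacher {S : Type*} [MeasurableSpace S] (Ψ : Set (S → ℝ)) (P : Measure S) (n : ℕ) : ℝ :=
  ∫ y, empRademacher Ψ y ∂(Measure.pi (fun _ : Fin n => P))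

/-- `Δ_{f,n} = inf_{z ∈ [z₀ - (β - α), z₀]} n (-z + ((n-1)/n) f^*(z) + (1/n) f^*(β - α + z))`. -/
def delta (a b : EReal) (f : ℝ → ℝ) (α β : ℝ) (n : ℕ) : ℝ :=
  sInf ((fun z : ℝ => (n : ℝ) * (-z + ((n : ℝ) - 1) / n * conjReal a b f z
      + 1 / n * conjReal a b f (β - α + z))) '' Icc (zZero f - (β - α)) (zZero f))

/-- The second (always available) bound,
`(f^*)'_+(β - α + z₀) (𝓡_{Ψ,P,n} + (β - α) / (2 √n))`. -/
def kappaBasic {S : Type*} [MeasurableSpace S] (a b : EReal) (f : ℝ → ℝ) (α β : ℝ)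
    (Ψ : Set (S → ℝ)) (P : Measure S) (n : ℕ) : ℝ :=
  rightDeriv (conjReal a b f) (β - α + zZero f)
    * (rademacher Ψ P n + (β - α) / (2 * √(n : ℝ)))

open Classical in
/-- `𝓚_{f,Ψ,P,n}`. If `(f^*)'_+` is `L`-Lipschitz on `[z₀ - (β - α), z₀ + β - α]` and `Ψ` contains
a constant function it is the minimum of two bounds, otherwise it is `kappaBasic`. -/
def kappa {S : Type*} [MeasurableSpace S] (a b : EReal) (f : ℝ → ℝ) (α β : ℝ) (L : ℝ≥0)
    (Ψ : Set (S → ℝ)) (P : Measure S) (n : ℕ) : ℝ :=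
  if LipschitzOnWith L (rightDeriv (conjReal a b f))
        (Icc (zZero f - (β - α)) (zZero f + β - α))
      ∧ ∃ c : ℝ, (fun _ : S => c) ∈ Ψ then
    min ((1 + 2 * (β - α) * L) * rademacher Ψ P n + (β - α) ^ 2 * L / (2 * √(n : ℝ)))
      (kappaBasic a b f α β Ψ P n)
  else kappaBasic a b f α β Ψ P n

end FGamma

end

/-! Write `z₀` for `zZero f`. It is a subgradient of `f` at `1`, so `f^*` has slope at most `1` to
the left of `z₀` and at least `1` to the right. Hence moving a shift `ν` outside `[α - z₀, β - z₀]`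
to the nearest endpoint cannot increase `ν + E_P[f^*(h - ν)]`, and the cumulant is an infimum over
that compact interval (`IsTest.cumulant_eq`). For such shifts `h - ν` stays where `f^*` is finite,
bounded and Lipschitz. The cumulant is therefore real and Lipschitz in `L¹(P)`, the class and the
shifts can be replaced by countable dense families, and the empirical divergence is a bounded
measurable function of `n + m` independent points.

Both tails come from McDiarmid's inequality. Replacing one `X_i` moves a sample mean by at most `(β
- α) / n`. Replacing one `X'_i` moves the empirical cumulant by at most `Δ / m`
(`IsTest.cumulantReal_sub_le`): the map `(u, ν) ↦ f^*(u - ν)` is submodular, which allows a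
comparison with a fictitious sample taking the value `β` at the changed point and `α` elsewhere. The
sum of the squared differences is the denominator in the exponent.

It remains to compare the mean of the empirical divergence with the true divergence. It is never
smaller, since the expectation of a supremum dominates the supremum of expectations and the reverse
holds for infima. It is larger by at most the expected uniform deviations of the sample means of `h`
and of `f^*(h - ν)`. Symmetrization bounds these by twice Rademacher averages, and Talagrand's
contraction removes `f^*`. Either `f^*` itself is contracted, with Lipschitz constant `(f^*)'_+(β -
α + z₀)`; or, when `(f^*)'_+` is `L`-Lipschitz, so that it equals `1` at `z₀`, one writes `f^*(h -
ν) + ν = h + (f^* - id)(h - ν)` and contracts `f^* - id`, with constant `(β - α) L`. The family of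
shifts costs `(β - α) / (2 √m)` by Khintchine's inequality. -/

namespace FGamma

/-! ### McDiarmid's bounded difference inequality. -/

/-- Hoeffding's lemma applied fibrewise to a function on a product. -/
theorem integral_exp_prod_le_of_bounded_difference {S T : Type*} [MeasurableSpace S]
    [MeasurableSpace T] (μ : Measure S) (ν : Measure T) [IsProbabilityMeasure μ]
    [IsProbabilityMeasure ν] (F : S × T → ℝ) (hF : Measurable F) (B : ℝ) (hB : ∀ p, |F p| ≤ B)
    (c : ℝ) (hc : ∀ x x' y, |F (x, y) - F (x', y)| ≤ c) (t : ℝ) :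
    ∫ p, Real.exp (t * F p) ∂(μ.prod ν)
      ≤ Real.exp (t ^ 2 * c ^ 2 / 8) * ∫ y, Real.exp (t * ∫ x, F (x, y) ∂μ) ∂ν := by
  have hexp : Integrable (fun p => Real.exp (t * F p)) (μ.prod ν) := by
    refine Integrable.of_bound (by fun_prop) (Real.exp (|t| * B)) (.of_forall fun p => ?_)
    rw [Real.norm_eq_abs, Real.abs_exp]
    refine Real.exp_le_exp.2 <| (le_abs_self _).trans
      ((abs_mul t _).le.trans (mul_le_mul_of_nonneg_left (hB p) (abs_nonneg t)))
  have hsm : StronglyMeasurable fun y => ∫ x, F (x, y) ∂μ :=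
    hF.stronglyMeasurable.integral_prod_left'
  rw [integral_prod_symm _ hexp, ← integral_const_mul]
  have hbar : ∀ y, |∫ x, F (x, y) ∂μ| ≤ B := fun y => by
    have := norm_integral_le_of_norm_le_const (μ := μ) (f := fun x => F (x, y)) (C := B)
      (.of_forall fun x => hB (x, y))
    simpa using this
  refine integral_mono hexp.integral_prod_right ?_ fun y => ?_
  · refine Integrable.const_mul (Integrable.of_bound ?_ (Real.exp (|t| * B))
      (.of_forall fun y => ?_)) _
    · exact (Real.continuous_exp.measurable.comp
        (hsm.measurable.const_mul t)).aestronglyMeasurable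
    · rw [Real.norm_eq_abs, Real.abs_exp]
      refine Real.exp_le_exp.2 <| (le_abs_self _).trans
        ((abs_mul t _).le.trans (mul_le_mul_of_nonneg_left (hbar y) (abs_nonneg t)))
  · have hne : Nonempty S := nonempty_of_isProbabilityMeasure μ
    have hc0 : 0 ≤ c := (abs_nonneg _).trans (hc hne.some hne.some y)
    have hbelow : BddBelow (range fun x => F (x, y)) :=
      ⟨-B, by rintro _ ⟨x, rfl⟩; exact (abs_le.1 (hB _)).1⟩
    -- The fibre `F (·, y)` takes values in an interval of length `c`, so Hoeffding's lemma gives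
    -- the variance proxy `(c / 2) ^ 2`, hence the exponent `t ^ 2 * c ^ 2 / 8`.
    set m := ⨅ x, F (x, y)
    have hmem : ∀ x, F (x, y) ∈ Icc m (m + c) := fun x => by
      refine ⟨ciInf_le hbelow x, ?_⟩
      have : F (x, y) - c ≤ m := le_ciInf fun x' => by
        linarith [(abs_le.1 (hc x x' y)).2]
      linarith
    have hsub := hasSubgaussianMGF_of_mem_Icc (μ := μ) (X := fun x => F (x, y))
      (hF.comp measurable_prodMk_right).aemeasurable (.of_forall hmem)
    have hle := hsub.mgf_le t
    have hsplit : ∀ x, Real.exp (t * F (x, y))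
        = Real.exp (t * ∫ x, F (x, y) ∂μ)
          * Real.exp (t * (F (x, y) - ∫ x, F (x, y) ∂μ)) := fun x => by
      rw [← Real.exp_add]; ring_nf
    simp only [hsplit]
    rw [integral_const_mul, mul_comm]
    refine mul_le_mul_of_nonneg_right (hle.trans (le_of_eq ?_)) (Real.exp_nonneg _)
    congr 1
    simp only [add_sub_cancel_left, NNReal.coe_pow, NNReal.coe_div, coe_nnnorm, Real.norm_eq_abs,
      NNReal.coe_ofNat, abs_of_nonneg hc0]
    ring

/-- Induction on the number of coordinates. Averaging over coordinate `0` keeps the bounded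
differences in the remaining ones, so the induction hypothesis applies to the averaged function, and
coordinate `0` contributes its own Hoeffding factor. -/
theorem integral_exp_pi_le_of_bounded_difference {S : Type*} [MeasurableSpace S] (t : ℝ) :
    ∀ (N : ℕ) (μ : Fin N → Measure S) [∀ i, IsProbabilityMeasure (μ i)] (F : (Fin N → S) → ℝ)
      (_ : Measurable F) (B : ℝ) (_ : ∀ x, |F x| ≤ B) (c : Fin N → ℝ)
      (_ : ∀ i x y, (∀ j, j ≠ i → x j = y j) → |F x - F y| ≤ c i),
      ∫ x, Real.exp (t * F x) ∂(Measure.pi μ)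
        ≤ Real.exp (t * ∫ x, F x ∂(Measure.pi μ) + t ^ 2 * (∑ i, c i ^ 2) / 8) := by
  intro N
  induction N with
  | zero =>
    intro μ _ F hF B hB c hc
    have : ∀ x, F x = F (fun i => i.elim0) := fun x => by congr 1; ext i; exact i.elim0
    simp only [fun x => this x]
    simp
  | succ N ih =>
    intro μ _ F hF B hB c hc
    have hmp := (measurePreserving_piFinSuccAbove μ 0).symm
    set e := (MeasurableEquiv.piFinSuccAbove (fun _ : Fin (N + 1) => S) 0).symm
    have he : ∀ p : S × (Fin N → S), e p = Fin.cons p.1 p.2 := fun p => by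
      change (Fin.insertNthEquiv (fun _ => S) 0) p = _
      simp
      rfl
    set ν := Measure.pi fun j : Fin N => μ (Fin.succAbove 0 j)
    have hFe : Measurable fun p => F (e p) := hF.comp e.measurable
    have hint : Integrable (fun p => F (e p)) ((μ 0).prod ν) :=
      Integrable.of_bound hFe.aestronglyMeasurable B (.of_forall fun p => hB _)
    have hsm : StronglyMeasurable fun y => ∫ x, F (e (x, y)) ∂(μ 0) :=
      hFe.stronglyMeasurable.integral_prod_left'
    have h1 : ∫ x, Real.exp (t * F x) ∂(Measure.pi μ)
        = ∫ p, Real.exp (t * F (e p)) ∂((μ 0).prod ν) :=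
      (hmp.integral_comp e.measurableEmbedding (fun x => Real.exp (t * F x))).symm
    have h2 : ∫ x, F x ∂(Measure.pi μ) = ∫ y, ∫ x, F (e (x, y)) ∂(μ 0) ∂ν := by
      rw [← hmp.integral_comp e.measurableEmbedding F, integral_prod_symm _ hint]
    have hI : ∀ y, Integrable (fun x => F (e (x, y))) (μ 0) := fun y =>
      Integrable.of_bound (hFe.comp measurable_prodMk_right).aestronglyMeasurable B
        (.of_forall fun p => hB _)
    have h3 := ih (fun j => μ (Fin.succAbove 0 j)) (fun y => ∫ x, F (e (x, y)) ∂(μ 0))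
      hsm.measurable B (fun y => by
        have := norm_integral_le_of_norm_le_const (μ := μ 0) (f := fun x => F (e (x, y))) (C := B)
          (.of_forall fun x => hB _)
        simpa using this) (fun j => c j.succ) (fun i y y' hy => by
        rw [← integral_sub (hI y) (hI y')]
        have := norm_integral_le_of_norm_le_const (μ := μ 0)
          (f := fun x => F (e (x, y)) - F (e (x, y'))) (C := c i.succ)
          (.of_forall fun x => hc _ _ _ fun j => ?_)
        · simpa using this
        · simp only [he]
          refine Fin.cases ?_ (fun j hj => ?_) j
          · simp
          · simpa using hy j fun h => hj (by rw [h]))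
    have h4 := integral_exp_prod_le_of_bounded_difference (μ 0) ν (fun p => F (e p)) hFe B
      (fun p => hB _) (c 0) (fun x x' y => hc _ _ _ fun j => by
        simp only [he]
        refine Fin.cases ?_ (fun j _ => ?_) j
        · simp
        · simp) t
    rw [h1, h2]
    refine h4.trans ((mul_le_mul_of_nonneg_left h3 (Real.exp_nonneg _)).trans (le_of_eq ?_))
    rw [← Real.exp_add, Fin.sum_univ_succ]
    congr 1
    ring

/-- **McDiarmid's inequality** for independent random variables. -/
theorem measureReal_ge_le_of_bounded_difference {S Ω ι : Type*} [MeasurableSpace S]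
    [MeasurableSpace Ω] [Fintype ι] (P : Measure Ω) [IsProbabilityMeasure P] (Z : ι → Ω → S)
    (hZ : ∀ i, Measurable (Z i)) (hind : iIndepFun Z P) (F : (ι → S) → ℝ) (hF : Measurable F)
    (B : ℝ) (hB : ∀ x, |F x| ≤ B) (c : ι → ℝ)
    (hc : ∀ i x y, (∀ j, j ≠ i → x j = y j) → |F x - F y| ≤ c i) (hpos : 0 < ∑ i, c i ^ 2)
    (ε : ℝ) (hε : 0 < ε) :
    P.real {ω | ε ≤ F (fun i => Z i ω) - ∫ ω, F (fun i => Z i ω) ∂P}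
      ≤ Real.exp (-(2 * ε ^ 2 / ∑ i, c i ^ 2)) := by
  set e := (Fintype.equivFin ι).symm
  set F' : (Fin (Fintype.card ι) → S) → ℝ := fun x => F (fun i => x (e.symm i))
  have hF' : Measurable F' := hF.comp (measurable_pi_lambda _ fun i => measurable_pi_apply _)
  have hZe : Measurable fun ω k => Z (e k) ω := measurable_pi_lambda _ fun k => hZ _
  have hmap := (iIndepFun_iff_map_fun_eq_pi_map (fun k => (hZ (e k)).aemeasurable)).1
    (hind.precomp (g := e) e.injective)
  have hprob : ∀ k, IsProbabilityMeasure (P.map (Z (e k))) := fun k =>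
    Measure.isProbabilityMeasure_map (hZ _).aemeasurable
  have hFF : ∀ ω, F' (fun k => Z (e k) ω) = F (fun i => Z i ω) := fun ω => by simp [F']
  have hFm : Measurable fun ω => F (fun i => Z i ω) :=
    hF.comp (measurable_pi_lambda _ hZ)
  have key : ∀ t, ∫ ω, Real.exp (t * F (fun i => Z i ω)) ∂P
      ≤ Real.exp (t * ∫ ω, F (fun i => Z i ω) ∂P + t ^ 2 * (∑ i, c i ^ 2) / 8) := fun t => by
    have := integral_exp_pi_le_of_bounded_difference t _ (fun k => P.map (Z (e k))) F' hF' B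
      (fun x => hB _) (fun k => c (e k)) (fun k x y h => hc _ _ _ fun j hj => h _ fun h' => hj (by
        rw [← h', Equiv.apply_symm_apply]))
    rw [← hmap, integral_map hZe.aemeasurable (by fun_prop), integral_map hZe.aemeasurable
      hF'.aestronglyMeasurable, Equiv.sum_comp e (fun i => c i ^ 2)] at this
    simpa only [hFF] using this
  set E := ∫ ω, F (fun i => Z i ω) ∂P
  set s := ∑ i, c i ^ 2
  -- The minimizer of the Chernoff exponent `-t ε + t ^ 2 s / 8`, with minimum `-2 ε ^ 2 / s`.
  set t := 4 * ε / s
  have ht : 0 ≤ t := by positivity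
  have hint : Integrable (fun ω => Real.exp (t * (F (fun i => Z i ω) - E))) P := by
    refine Integrable.of_bound (Real.measurable_exp.comp
      ((hFm.sub_const E).const_mul t)).aestronglyMeasurable (Real.exp (t * (B - E))) (.of_forall fun ω => ?_)
    rw [Real.norm_eq_abs, Real.abs_exp]
    gcongr
    exact (le_abs_self _).trans (hB _)
  refine (measure_ge_le_exp_mul_mgf ε ht hint).trans ?_
  have hmgf : mgf (fun ω => F (fun i => Z i ω) - E) P t ≤ Real.exp (t ^ 2 * s / 8) := by
    unfold mgf
    simp only [mul_sub, Real.exp_sub]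
    rw [integral_div, div_le_iff₀ (Real.exp_pos _), ← Real.exp_add]
    exact (key t).trans (le_of_eq (by ring_nf))
  refine (mul_le_mul_of_nonneg_left hmgf (Real.exp_nonneg _)).trans (le_of_eq ?_)
  rw [← Real.exp_add]
  congr 1
  simp only [t]
  field_simp
  ring

/-! ### Rademacher averages, contraction and Khintchine's inequality. -/

theorem bddAbove_range_of_abs_le {ι : Type*} {A : ι → ℝ} {C : ℝ} (h : ∀ t, |A t| ≤ C) :
    BddAbove (range A) :=
  ⟨C, by rintro _ ⟨t, rfl⟩; exact (le_abs_self _).trans (h t)⟩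

theorem abs_ciSup_le {ι : Type*} [Nonempty ι] {A : ι → ℝ} {C : ℝ} (h : ∀ t, |A t| ≤ C) :
    |⨆ t, A t| ≤ C := by
  obtain ⟨t⟩ := ‹Nonempty ι›
  exact abs_le.2 ⟨(abs_le.1 (h t)).1.trans (le_ciSup (bddAbove_range_of_abs_le h) t),
    ciSup_le fun s => (le_abs_self _).trans (h s)⟩

/-- The value of a sign as a real number. -/
abbrev sgn (s : ℤˣ) : ℝ := ((s : ℤ) : ℝ)

theorem abs_sgn (s : ℤˣ) : |sgn s| = 1 := by
  rcases Int.units_eq_one_or s with rfl | rfl <;> simp [sgn]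

theorem sum_sign_eq (f : ℤˣ → ℝ) : ∑ s, f s = f 1 + f (-1) := by
  rw [show (Finset.univ : Finset ℤˣ) = {1, -1} from rfl, Finset.sum_pair (by decide)]

theorem sum_signs_succ {n : ℕ} (f : (Fin (n + 1) → ℤˣ) → ℝ) :
    ∑ σ, f σ = ∑ σ : Fin n → ℤˣ, (f (Fin.cons 1 σ) + f (Fin.cons (-1) σ)) := by
  rw [← (Fin.consEquiv fun _ : Fin (n + 1) => ℤˣ).sum_comp, Fintype.sum_prod_type, sum_sign_eq,
    ← Finset.sum_add_distrib]
  rfl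

theorem abs_signed_sum_le {n : ℕ} (σ : Fin n → ℤˣ) {v : Fin n → ℝ} {C : ℝ}
    (hv : ∀ i, |v i| ≤ C) : |∑ i, sgn (σ i) * v i| ≤ n * C := by
  refine (Finset.abs_sum_le_sum_abs _ _).trans ?_
  have := Finset.sum_le_card_nsmul Finset.univ (fun i => |sgn (σ i) * v i|) C fun i _ => by
    rw [abs_mul, abs_sgn, one_mul]; exact hv i
  simpa using this

/-- The two-point step of the contraction principle. For candidates `t` and `s` in the two suprema
on the left, `w t - w s ≤ |u t - u s|`; the sign of `u t - u s` decides which of them is used in the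
supremum with `+ u` on the right. -/
theorem ciSup_add_ciSup_sub_le {ι : Type*} [Nonempty ι] {A u w : ι → ℝ} {C : ℝ}
    (hA : ∀ t, |A t| ≤ C) (hu : ∀ t, |u t| ≤ C) (h : ∀ t s, |w t - w s| ≤ |u t - u s|) :
    (⨆ t, (A t + w t)) + (⨆ t, (A t - w t)) ≤ (⨆ t, (A t + u t)) + ⨆ t, (A t - u t) := by
  have b1 : BddAbove (range fun t => A t + u t) :=
    bddAbove_range_of_abs_le (C := C + C) fun t => (abs_add_le _ _).trans (add_le_add (hA t) (hu t))
  have b2 : BddAbove (range fun t => A t - u t) :=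
    bddAbove_range_of_abs_le (C := C + C) fun t => (abs_sub _ _).trans (add_le_add (hA t) (hu t))
  rw [← le_sub_iff_add_le]
  refine ciSup_le fun t => ?_
  rw [le_sub_comm]
  refine ciSup_le fun s => ?_
  have h1 := le_ciSup b1 t
  have h2 := le_ciSup b1 s
  have h3 := le_ciSup b2 t
  have h4 := le_ciSup b2 s
  have h5 := (le_abs_self _).trans (h t s)
  rcases abs_cases (u t - u s) with ⟨e, _⟩ | ⟨e, _⟩ <;> rw [e] at h5 <;> linarith

/-- Talagrand's contraction principle, without absolute values. -/
theorem sum_signs_ciSup_le_of_contraction {ι : Type*} [Nonempty ι] {C : ℝ} : ∀ {n : ℕ}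
    (A : ι → ℝ) (_ : ∃ D, ∀ t, |A t| ≤ D) (w v : Fin n → ι → ℝ) (_ : ∀ i t, |w i t| ≤ C)
    (_ : ∀ i t, |v i t| ≤ C) (_ : ∀ i t s, |w i t - w i s| ≤ |v i t - v i s|),
    ∑ σ : Fin n → ℤˣ, ⨆ t, (A t + ∑ i, sgn (σ i) * w i t)
      ≤ ∑ σ : Fin n → ℤˣ, ⨆ t, (A t + ∑ i, sgn (σ i) * v i t) := by
  intro n
  induction n with
  | zero => intro A _ w v _ _ _; simp
  | succ n ih =>
    rintro A ⟨D, hD⟩ w v hw hv h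
    have hb : ∀ s : ℤˣ, ∀ t, |A t + sgn s * w 0 t| ≤ D + C := fun s t =>
      (abs_add_le _ _).trans (add_le_add (hD t) (by rw [abs_mul, abs_sgn, one_mul]; exact hw 0 t))
    -- The free term `A` absorbs coordinate `0` with its sign fixed, so the induction hypothesis
    -- contracts all other coordinates. Pairing the two signs then contracts coordinate `0`.
    have ih' := fun s : ℤˣ => ih (fun t => A t + sgn s * w 0 t) ⟨_, hb s⟩
      (fun i => w i.succ) (fun i => v i.succ) (fun i => hw _) (fun i => hv _) (fun i => h _)
    rw [sum_signs_succ, sum_signs_succ]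
    simp only [Fin.sum_univ_succ, Fin.cons_zero, Fin.cons_succ, ← add_assoc]
    rw [Finset.sum_add_distrib]
    refine (add_le_add (ih' 1) (ih' (-1))).trans ?_
    rw [← Finset.sum_add_distrib]
    refine Finset.sum_le_sum fun σ _ => ?_
    have hS : ∀ t, |A t + ∑ i, sgn (σ i) * v i.succ t| ≤ max (D + n * C) C := fun t =>
      le_max_of_le_left <| (abs_add_le _ _).trans
        (add_le_add (hD t) (abs_signed_sum_le σ fun i => hv _ t))
    have := ciSup_add_ciSup_sub_le hS (fun t => le_max_of_le_right (hv 0 t)) (h 0)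
    have e1 : ∀ t, A t + sgn 1 * w 0 t + ∑ i, sgn (σ i) * v i.succ t
        = A t + ∑ i, sgn (σ i) * v i.succ t + w 0 t := fun t => by simp [sgn]; ring
    have e2 : ∀ t, A t + sgn (-1) * w 0 t + ∑ i, sgn (σ i) * v i.succ t
        = A t + ∑ i, sgn (σ i) * v i.succ t - w 0 t := fun t => by simp [sgn]; ring
    have e3 : ∀ t, A t + sgn 1 * v 0 t + ∑ i, sgn (σ i) * v i.succ t
        = A t + ∑ i, sgn (σ i) * v i.succ t + v 0 t := fun t => by simp [sgn]; ring
    have e4 : ∀ t, A t + sgn (-1) * v 0 t + ∑ i, sgn (σ i) * v i.succ t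
        = A t + ∑ i, sgn (σ i) * v i.succ t - v 0 t := fun t => by simp [sgn]; ring
    simpa only [e1, e2, e3, e4] using this

theorem sum_signs_sq {n : ℕ} : ∑ σ : Fin n → ℤˣ, (∑ i, sgn (σ i)) ^ 2 = 2 ^ n * n := by
  induction n with
  | zero => simp
  | succ n ih =>
    rw [sum_signs_succ]
    simp only [Fin.sum_univ_succ, Fin.cons_zero, Fin.cons_succ]
    have : ∀ x : ℝ, (sgn 1 + x) ^ 2 + (sgn (-1) + x) ^ 2 = 2 + 2 * x ^ 2 := fun x => by
      simp [sgn]; ring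
    simp only [this, Finset.sum_add_distrib, ← Finset.mul_sum, ih]
    simp
    ring

theorem sum_signs_neg {n : ℕ} (f : (Fin n → ℤˣ) → ℝ) : ∑ σ, f (-σ) = ∑ σ, f σ :=
  Equiv.sum_comp (Equiv.neg (Fin n → ℤˣ)) f

theorem sum_signs_eq_zero {n : ℕ} (v : Fin n → ℝ) :
    ∑ σ : Fin n → ℤˣ, ∑ i, sgn (σ i) * v i = 0 := by
  have := sum_signs_neg fun σ : Fin n → ℤˣ => ∑ i, sgn (σ i) * v i
  simp [sgn] at this ⊢
  linarith

/-- Khintchine's inequality for unit coefficients. -/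
theorem sum_signs_abs_le {n : ℕ} :
    ∑ σ : Fin n → ℤˣ, |∑ i, sgn (σ i)| ≤ 2 ^ n * √(n : ℝ) := by
  have h := sq_sum_le_card_mul_sum_sq (s := (Finset.univ : Finset (Fin n → ℤˣ)))
    (f := fun σ => |∑ i, sgn (σ i)|)
  simp only [sq_abs, sum_signs_sq, Finset.card_univ, Fintype.card_pi, Finset.prod_const,
    Fintype.card_units_int, Fintype.card_fin] at h
  refine abs_le_of_sq_le_sq' ?_ (by positivity) |>.2
  refine h.trans (le_of_eq ?_)
  rw [mul_pow, Real.sq_sqrt (by positivity)]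
  push_cast
  ring

/-- The Rademacher average `E_σ[sup_t (1/n) ∑ᵢ σᵢ vᵢ(t)]` of an indexed family. -/
noncomputable def radMean {ι : Type*} {n : ℕ} (v : Fin n → ι → ℝ) : ℝ :=
  (1 / 2 ^ n : ℝ) * ∑ σ : Fin n → ℤˣ, ⨆ t, (1 / n : ℝ) * ∑ i, sgn (σ i) * v i t

theorem radMean_neg {ι : Type*} {n : ℕ} (v : Fin n → ι → ℝ) :
    radMean (fun i t => -v i t) = radMean v := by
  unfold radMean
  congr 1
  rw [← sum_signs_neg]
  simp [sgn]

theorem integrable_of_abs_le {T : Type*} [MeasurableSpace T] {μ : Measure T} [IsFiniteMeasure μ]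
    {F : T → ℝ} (hF : Measurable F) {C : ℝ} (h : ∀ x, |F x| ≤ C) : Integrable F μ :=
  Integrable.of_bound hF.aestronglyMeasurable C (.of_forall h)

theorem abs_mean_le {n : ℕ} {v : Fin n → ℝ} {C : ℝ} (hC : 0 ≤ C) (hv : |∑ i, v i| ≤ n * C) :
    |(1 / n : ℝ) * ∑ i, v i| ≤ C := by
  rw [abs_mul, abs_of_nonneg (by positivity : (0 : ℝ) ≤ 1 / n)]
  -- For `n = 0` the mean is `0`, because `1 / 0 = 0`.
  rcases Nat.eq_zero_or_pos n with rfl | hn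
  · simpa using hC
  · refine (mul_le_mul_of_nonneg_left hv (by positivity)).trans (le_of_eq ?_)
    field_simp

theorem abs_signed_mean_le {n : ℕ} (σ : Fin n → ℤˣ) {v : Fin n → ℝ} {C : ℝ} (hC : 0 ≤ C)
    (hv : ∀ i, |v i| ≤ C) : |(1 / n : ℝ) * ∑ i, sgn (σ i) * v i| ≤ C :=
  abs_mean_le hC (abs_signed_sum_le σ hv)

theorem abs_radMean_le {ι : Type*} [Nonempty ι] {n : ℕ} {v : Fin n → ι → ℝ} {C : ℝ} (hC : 0 ≤ C)
    (hv : ∀ i t, |v i t| ≤ C) : |radMean v| ≤ C := by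
  unfold radMean
  rw [abs_mul, abs_of_nonneg (by positivity)]
  have h1 : |∑ σ : Fin n → ℤˣ, ⨆ t, (1 / n : ℝ) * ∑ i, sgn (σ i) * v i t|
      ≤ ∑ σ : Fin n → ℤˣ, C := by
    refine (Finset.abs_sum_le_sum_abs _ _).trans (Finset.sum_le_sum fun σ _ => ?_)
    exact abs_ciSup_le fun t => abs_signed_mean_le σ hC fun i => hv i t
  refine (mul_le_mul_of_nonneg_left h1 (by positivity)).trans (le_of_eq ?_)
  simp

theorem measurable_radMean {T ι : Type*} [MeasurableSpace T] [Countable ι] {n : ℕ}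
    {v : T → Fin n → ι → ℝ} (hv : ∀ i t, Measurable fun x => v x i t) :
    Measurable fun x => radMean (v x) :=
  (Finset.measurable_sum _ fun _ _ => Measurable.iSup fun _ =>
    (Finset.measurable_sum _ fun _ _ => (hv _ _).const_mul _).const_mul _).const_mul _

theorem radMean_nonneg {ι : Type*} [Nonempty ι] {n : ℕ} {v : Fin n → ι → ℝ} {C : ℝ} (hC : 0 ≤ C)
    (hv : ∀ i t, |v i t| ≤ C) : 0 ≤ radMean v := by
  obtain ⟨t⟩ := ‹Nonempty ι›
  refine mul_nonneg (by positivity) ?_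
  calc (0 : ℝ) = ∑ σ : Fin n → ℤˣ, (1 / n : ℝ) * ∑ i, sgn (σ i) * v i t := by
        rw [← Finset.mul_sum, sum_signs_eq_zero, mul_zero]
    _ ≤ _ := Finset.sum_le_sum fun σ _ => le_ciSup
        (f := fun t => (1 / n : ℝ) * ∑ i, sgn (σ i) * v i t)
        (bddAbove_range_of_abs_le fun t => abs_signed_mean_le σ hC fun i => hv i t) t

/-- The contraction principle for Rademacher averages. -/
theorem radMean_le_of_contraction {ι : Type*} [Nonempty ι] {C : ℝ} {n : ℕ} {w v : Fin n → ι → ℝ}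
    (hw : ∀ i t, |w i t| ≤ C) (hv : ∀ i t, |v i t| ≤ C)
    (h : ∀ i t s, |w i t - w i s| ≤ |v i t - v i s|) : radMean w ≤ radMean v := by
  unfold radMean
  refine mul_le_mul_of_nonneg_left ?_ (by positivity)
  simp only [← Real.mul_iSup_of_nonneg (by positivity : (0 : ℝ) ≤ 1 / n), ← Finset.mul_sum]
  refine mul_le_mul_of_nonneg_left ?_ (by positivity)
  simpa using sum_signs_ciSup_le_of_contraction (fun _ : ι => (0 : ℝ)) ⟨0, by simp⟩ w v hw hv h

theorem radMean_const_mul {ι : Type*} {n : ℕ} (v : Fin n → ι → ℝ) {M : ℝ} (hM : 0 ≤ M) :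
    radMean (fun i t => M * v i t) = M * radMean v := by
  unfold radMean
  rw [mul_left_comm]
  congr 1
  rw [Finset.mul_sum]
  refine Finset.sum_congr rfl fun σ _ => ?_
  rw [Real.mul_iSup_of_nonneg hM]
  refine iSup_congr fun t => ?_
  rw [mul_left_comm, Finset.mul_sum _ _ M]
  simp only [mul_left_comm M]

theorem radMean_add_le {ι : Type*} [Nonempty ι] {C : ℝ} (hC : 0 ≤ C) {n : ℕ}
    {v w : Fin n → ι → ℝ} (hv : ∀ i t, |v i t| ≤ C) (hw : ∀ i t, |w i t| ≤ C) :
    radMean (fun i t => v i t + w i t) ≤ radMean v + radMean w := by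
  unfold radMean
  rw [← mul_add, ← Finset.sum_add_distrib]
  refine mul_le_mul_of_nonneg_left (Finset.sum_le_sum fun σ _ => ?_) (by positivity)
  refine ciSup_le fun t => ?_
  simp only [mul_add, Finset.sum_add_distrib]
  exact add_le_add
    (le_ciSup (f := fun t => (1 / n : ℝ) * ∑ i, sgn (σ i) * v i t)
      (bddAbove_range_of_abs_le fun t => abs_signed_mean_le σ hC fun i => hv i t) t)
    (le_ciSup (f := fun t => (1 / n : ℝ) * ∑ i, sgn (σ i) * w i t)
      (bddAbove_range_of_abs_le fun t => abs_signed_mean_le σ hC fun i => hw i t) t)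

theorem radMean_comp_le {ι κ : Type*} [Nonempty κ] {C : ℝ} (hC : 0 ≤ C) {n : ℕ}
    {v : Fin n → ι → ℝ} (hv : ∀ i t, |v i t| ≤ C) (p : κ → ι) :
    radMean (fun i t => v i (p t)) ≤ radMean v := by
  unfold radMean
  refine mul_le_mul_of_nonneg_left (Finset.sum_le_sum fun σ _ => ?_) (by positivity)
  exact ciSup_le fun t => le_ciSup (f := fun t => (1 / n : ℝ) * ∑ i, sgn (σ i) * v i t)
      (bddAbove_range_of_abs_le fun t => abs_signed_mean_le σ hC fun i => hv i t) (p t)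

/-- The Rademacher average of a bounded family of constants. -/
theorem radMean_const_le {ι : Type*} [Nonempty ι] {n : ℕ} (hn : 0 < n) (q : ι → ℝ) (a r : ℝ)
    (hq : ∀ t, |q t - a| ≤ r) : radMean (fun (_ : Fin n) t => q t) ≤ r / √(n : ℝ) := by
  -- Centring at `a`: the part with `a` is linear in the signs and averages to zero, and the
  -- remainder is at most `r * |∑ σᵢ|`, which Khintchine's inequality controls.
  have hsup : ∀ σ : Fin n → ℤˣ, (⨆ t, (1 / n : ℝ) * ∑ i, sgn (σ i) * q t)
      ≤ (1 / n : ℝ) * ((∑ i, sgn (σ i) * a) + r * |∑ i, sgn (σ i)|) := fun σ => by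
    refine ciSup_le fun t => mul_le_mul_of_nonneg_left ?_ (by positivity)
    rw [← Finset.sum_mul, ← Finset.sum_mul, ← sub_le_iff_le_add', ← mul_sub]
    refine (le_abs_self _).trans ?_
    rw [abs_mul, mul_comm]
    exact mul_le_mul_of_nonneg_right (hq t) (abs_nonneg _)
  have hr : 0 ≤ r := by obtain ⟨t⟩ := ‹Nonempty ι›; exact (abs_nonneg _).trans (hq t)
  unfold radMean
  refine (mul_le_mul_of_nonneg_left (Finset.sum_le_sum fun σ _ => hsup σ)
    (by positivity)).trans ?_
  rw [← Finset.mul_sum, Finset.sum_add_distrib, sum_signs_eq_zero fun _ : Fin n => a, zero_add,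
    ← Finset.mul_sum]
  have h1 : (1 / 2 ^ n : ℝ) * (1 / n * (r * ∑ σ : Fin n → ℤˣ, |∑ i, sgn (σ i)|))
      ≤ (1 / 2 ^ n : ℝ) * (1 / n * (r * (2 ^ n * √(n : ℝ)))) := by
    gcongr
    exact sum_signs_abs_le
  refine h1.trans (le_of_eq ?_)
  have h2 : (0 : ℝ) < √n := Real.sqrt_pos.2 (by exact_mod_cast hn)
  have h3 : (n : ℝ) = √n * √n := (Real.mul_self_sqrt (by positivity)).symm
  rw [show (1 / n : ℝ) = 1 / (√n * √n) by rw [← h3]]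
  field_simp

/-! ### Symmetrization. -/

section Symmetrization

variable {S ι : Type*} [MeasurableSpace S] [Countable ι] [Nonempty ι]

/-- **Symmetrization**: the expected uniform deviation of empirical means is at most twice the
Rademacher complexity. -/
theorem integral_ciSup_mean_sub_le (P : Measure S) [IsProbabilityMeasure P] {n : ℕ} (hn : 0 < n)
    (g : ι → S → ℝ) (hg : ∀ k, Measurable (g k)) {C : ℝ} (hC : ∀ k x, |g k x| ≤ C) :
    ∫ y, ⨆ k, ((1 / n : ℝ) * ∑ i, g k (y i) - ∫ x, g k x ∂P) ∂(Measure.pi fun _ : Fin n => P)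
      ≤ 2 * ∫ y, radMean (fun i k => g k (y i)) ∂(Measure.pi fun _ : Fin n => P) := by
  set Pn := Measure.pi fun _ : Fin n => P
  have hS : Nonempty S := nonempty_of_isProbabilityMeasure P
  have hC0 : 0 ≤ C := (abs_nonneg _).trans (hC (Classical.arbitrary ι) hS.some)
  have hgm : ∀ k (i : Fin n), Measurable fun y : Fin n → S => g k (y i) := fun k i =>
    (hg k).comp (measurable_pi_apply i)
  set A : (Fin n → ℤˣ) → (Fin n → S) → ℝ := fun σ y =>
    ⨆ k, (1 / n : ℝ) * ∑ i, sgn (σ i) * g k (y i)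
  have hAm : ∀ σ, Measurable (A σ) := fun σ => Measurable.iSup fun k =>
    (Finset.measurable_sum _ fun i _ => (hgm k i).const_mul _).const_mul _
  have hAb : ∀ σ y, |A σ y| ≤ C := fun σ y =>
    abs_ciSup_le fun k => abs_signed_mean_le σ hC0 fun i => hC k _
  have hAi : ∀ σ, Integrable (A σ) Pn := fun σ => integrable_of_abs_le (hAm σ) (hAb σ)
  set H : (Fin n → ℤˣ) → (Fin n → S) × (Fin n → S) → ℝ := fun σ p =>
    ⨆ k, (1 / n : ℝ) * ∑ i, sgn (σ i) * (g k (p.1 i) - g k (p.2 i))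
  have hterm : ∀ σ : Fin n → ℤˣ, ∀ (p : (Fin n → S) × (Fin n → S)) k,
      |(1 / n : ℝ) * ∑ i, sgn (σ i) * (g k (p.1 i) - g k (p.2 i))| ≤ C + C := fun σ p k =>
    abs_signed_mean_le σ (by positivity) fun i => (abs_sub _ _).trans (add_le_add (hC _ _) (hC _ _))
  have hHm : ∀ σ, Measurable (H σ) := fun σ => Measurable.iSup fun k =>
    (Finset.measurable_sum _ fun i _ => (((hgm k i).comp measurable_fst).sub
      ((hgm k i).comp measurable_snd)).const_mul _).const_mul _
  have hHb : ∀ σ p, |H σ p| ≤ C + C := fun σ p => abs_ciSup_le fun k => hterm σ p k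
  have hHi : ∀ σ, Integrable (H σ) (Pn.prod Pn) := fun σ =>
    integrable_of_abs_le (hHm σ) (hHb σ)
  have hmean : ∀ k, ∫ y, (1 / n : ℝ) * ∑ i, g k (y i) ∂Pn = ∫ x, g k x ∂P := fun k => by
    rw [integral_const_mul, integral_finsetSum _ fun i _ =>
      integrable_of_abs_le (hgm k i) fun y => hC k _]
    have : ∀ i : Fin n, ∫ y, g k (y i) ∂Pn = ∫ x, g k x ∂P := fun i => by
      have hmp := measurePreserving_eval (fun _ : Fin n => P) i
      rw [← hmp.map_eq, integral_map hmp.measurable.aemeasurable (hg k).aestronglyMeasurable]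
    simp only [this]
    simp [hn.ne']
  -- The mean under `P` is the expected mean of an independent ghost sample, and the supremum of an
  -- expectation is at most the expectation of the supremum.
  have step1 : ∫ y, ⨆ k, ((1 / n : ℝ) * ∑ i, g k (y i) - ∫ x, g k x ∂P) ∂Pn
      ≤ ∫ p, H 1 p ∂(Pn.prod Pn) := by
    rw [integral_prod _ (hHi 1)]
    refine integral_mono (integrable_of_abs_le (C := C + C) ?_ fun y => ?_)
      (hHi 1).integral_prod_left fun y => ciSup_le fun k => ?_
    · exact Measurable.iSup fun k =>
        ((Finset.measurable_sum _ fun i _ => hgm k i).const_mul _).sub_const _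
    · refine abs_ciSup_le fun k => (abs_sub _ _).trans (add_le_add ?_ ?_)
      · have := abs_signed_mean_le (1 : Fin n → ℤˣ) hC0 fun i => hC k (y i)
        simpa [sgn] using this
      · simpa using norm_integral_le_of_norm_le_const (μ := P) (f := g k) (C := C)
          (.of_forall fun x => hC k x)
    · have h1 : (1 / n : ℝ) * ∑ i, g k (y i) - ∫ x, g k x ∂P
          = ∫ y', ((1 / n : ℝ) * ∑ i, g k (y i) - (1 / n : ℝ) * ∑ i, g k (y' i)) ∂Pn := by
        rw [integral_sub (integrable_const _), hmean]
        · simp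
        · exact (integrable_finsetSum _ fun i _ =>
            integrable_of_abs_le (hgm k i) fun y => hC k _).const_mul _
      rw [h1]
      refine integral_mono ((integrable_const _).sub ((integrable_finsetSum _ fun i _ =>
        integrable_of_abs_le (hgm k i) fun y => hC k _).const_mul _))
        (integrable_of_abs_le ((hHm 1).comp measurable_prodMk_left) fun y' => hHb 1 _)
        fun y' => ?_
      refine le_trans (le_of_eq ?_) (le_ciSup (bddAbove_range_of_abs_le (hterm 1 (y, y'))) k)
      simp [sgn, Finset.sum_sub_distrib, mul_sub]
  have step2 : ∀ σ, ∫ p, H σ p ∂(Pn.prod Pn) = ∫ p, H 1 p ∂(Pn.prod Pn) := fun σ => by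
    have hmp := measurePreserving_arrowProdEquivProdArrow S S (Fin n) (fun _ => P) (fun _ => P)
    set e := MeasurableEquiv.arrowProdEquivProdArrow S S (Fin n)
    rw [← hmp.integral_comp e.measurableEmbedding, ← hmp.integral_comp e.measurableEmbedding]
    -- Exchanging `yᵢ` with its ghost copy wherever `σ i = -1` preserves the product measure and
    -- inserts the signs.
    have hT := measurePreserving_pi (fun _ : Fin n => P.prod P) (fun _ : Fin n => P.prod P)
      (f := fun i => if σ i = 1 then id else Prod.swap) fun i => by
        split_ifs
        · exact MeasurePreserving.id _
        · exact Measure.measurePreserving_swap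
    conv_rhs => rw [← hT.map_eq]
    rw [integral_map (f := fun x => H 1 (e x)) hT.measurable.aemeasurable
      ((hHm 1).comp e.measurable).aestronglyMeasurable]
    refine integral_congr_ae (.of_forall fun w => ?_)
    refine iSup_congr fun k => ?_
    congr 1
    refine Finset.sum_congr rfl fun i _ => ?_
    rcases Int.units_eq_one_or (σ i) with h | h <;>
      simp [e, h, sgn, MeasurableEquiv.arrowProdEquivProdArrow, Equiv.arrowProdEquivProdArrow]
  -- The sample and its ghost are separated; the ghost carries the signs `-σ`, and `-σ` is again
  -- uniform once `σ` is averaged out in `step5`.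
  have step3 : ∀ σ, ∫ p, H σ p ∂(Pn.prod Pn) ≤ ∫ y, A σ y ∂Pn + ∫ y, A (-σ) y ∂Pn := fun σ => by
    have i1 : Integrable (fun p : (Fin n → S) × (Fin n → S) => A σ p.1) (Pn.prod Pn) :=
      (hAi σ).comp_fst _
    have i2 : Integrable (fun p : (Fin n → S) × (Fin n → S) => A (-σ) p.2) (Pn.prod Pn) :=
      (hAi (-σ)).comp_snd _
    calc ∫ p, H σ p ∂(Pn.prod Pn) ≤ ∫ p, (A σ p.1 + A (-σ) p.2) ∂(Pn.prod Pn) := by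
          refine integral_mono (hHi σ) (i1.add i2) fun p => ciSup_le fun k => ?_
          have e1 := le_ciSup (f := fun k => (1 / n : ℝ) * ∑ i, sgn (σ i) * g k (p.1 i))
            (bddAbove_range_of_abs_le fun k => abs_signed_mean_le σ hC0 fun i => hC k _) k
          have e2 := le_ciSup (f := fun k => (1 / n : ℝ) * ∑ i, sgn ((-σ) i) * g k (p.2 i))
            (bddAbove_range_of_abs_le fun k => abs_signed_mean_le (-σ) hC0 fun i => hC k _) k
          refine le_trans (le_of_eq ?_) (add_le_add e1 e2)
          rw [← mul_add, ← Finset.sum_add_distrib]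
          congr 1
          refine Finset.sum_congr rfl fun i _ => ?_
          simp [sgn]
          ring
      _ = _ := by
          rw [integral_add i1 i2, integral_fun_fst, integral_fun_snd]
          simp
  have step4 : ∫ y, radMean (fun i k => g k (y i)) ∂Pn
      = (1 / 2 ^ n : ℝ) * ∑ σ, ∫ y, A σ y ∂Pn := by
    rw [← integral_finsetSum _ fun σ _ => hAi σ, ← integral_const_mul]
    rfl
  have step5 : ∑ σ : Fin n → ℤˣ, ∫ p, H 1 p ∂(Pn.prod Pn) ≤ 2 * ∑ σ, ∫ y, A σ y ∂Pn := by
    refine (Finset.sum_le_sum fun σ _ => (step2 σ).symm.le.trans (step3 σ)).trans (le_of_eq ?_)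
    rw [Finset.sum_add_distrib, sum_signs_neg fun σ => ∫ y, A σ y ∂Pn]
    ring
  simp only [Finset.sum_const, Finset.card_univ, Fintype.card_pi, Finset.prod_const,
    Fintype.card_units_int, Fintype.card_fin, nsmul_eq_mul] at step5
  push_cast at step5
  rw [step4]
  refine step1.trans ?_
  have := mul_le_mul_of_nonneg_left step5 (by positivity : (0 : ℝ) ≤ 1 / 2 ^ n)
  calc ∫ p, H 1 p ∂(Pn.prod Pn) = 1 / 2 ^ n * (2 ^ n * ∫ p, H 1 p ∂(Pn.prod Pn)) := by
        field_simp
    _ ≤ _ := this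
    _ = _ := by ring

theorem integral_ciSup_sub_mean_le (P : Measure S) [IsProbabilityMeasure P] {n : ℕ} (hn : 0 < n)
    (g : ι → S → ℝ) (hg : ∀ k, Measurable (g k)) {C : ℝ} (hC : ∀ k x, |g k x| ≤ C) :
    ∫ y, ⨆ k, (∫ x, g k x ∂P - (1 / n : ℝ) * ∑ i, g k (y i)) ∂(Measure.pi fun _ : Fin n => P)
      ≤ 2 * ∫ y, radMean (fun i k => g k (y i)) ∂(Measure.pi fun _ : Fin n => P) := by
  have := integral_ciSup_mean_sub_le P hn (fun k x => -g k x) (fun k => (hg k).neg)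
    (fun k x => (abs_neg _).le.trans (hC k x))
  simp only [radMean_neg, integral_neg, Finset.sum_neg_distrib, mul_neg, sub_neg_eq_add,
    neg_add_eq_sub] at this
  exact this

end Symmetrization

/-! ### Convex functions on the real line. -/

section ConvexReal

variable {s : Set ℝ} {g : ℝ → ℝ} {x y : ℝ}

theorem rightDeriv_mul_le (hg : ConvexOn ℝ s g) (hx : x ∈ interior s) (hy : y ∈ s) (hxy : x < y) :
    rightDeriv g x * (y - x) ≤ g y - g x := by
  have := hg.rightDeriv_le_slope_of_mem_interior hx hy hxy
  rwa [slope_def_field, le_div_iff₀ (sub_pos.2 hxy)] at this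

theorem le_rightDeriv_mul (hg : ConvexOn ℝ s g) (hx : x ∈ s) (hy : y ∈ interior s) (hxy : x < y) :
    g y - g x ≤ rightDeriv g y * (y - x) := by
  have := (hg.slope_le_leftDeriv_of_mem_interior hx hy hxy).trans
    (hg.leftDeriv_le_rightDeriv_of_mem_interior hy)
  rwa [slope_def_field, div_le_iff₀ (sub_pos.2 hxy)] at this

/-- Convexity of `g` on `s` makes `g` submodular as a function of differences. -/
theorem convexOn_add_le_add (hg : ConvexOn ℝ s g) {p q u v : ℝ} (hp : p ∈ s)
    (hq : q ∈ s) (hpu : p ≤ u) (huq : u ≤ q) (hsum : u + v = p + q) :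
    g u + g v ≤ g p + g q := by
  rcases (hpu.trans huq).eq_or_lt with rfl | hlt
  · obtain rfl : u = p := le_antisymm huq hpu
    obtain rfl : v = u := by linarith
    exact le_rfl
  have hd : 0 < q - p := sub_pos.2 hlt
  -- The points `u` and `v` are convex combinations of `p` and `q` with the same two weights
  -- interchanged, so the two convexity inequalities add up to the claim.
  have h1 := hg.2 hp hq (div_nonneg (sub_nonneg.2 huq) hd.le) (div_nonneg (sub_nonneg.2 hpu) hd.le)
    (by field_simp; ring)
  have h2 := hg.2 hp hq (div_nonneg (sub_nonneg.2 hpu) hd.le) (div_nonneg (sub_nonneg.2 huq) hd.le)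
    (by field_simp; ring)
  simp only [smul_eq_mul] at h1 h2
  rw [show (q - u) / (q - p) * p + (u - p) / (q - p) * q = u by field_simp; ring] at h1
  rw [show (u - p) / (q - p) * p + (q - u) / (q - p) * q = v by
    rw [show v = p + q - u by linarith]; field_simp; ring] at h2
  have h3 : (q - u) / (q - p) + (u - p) / (q - p) = 1 := by field_simp; ring
  calc g u + g v ≤ ((q - u) / (q - p) + (u - p) / (q - p)) * (g p + g q) := by linarith
    _ = g p + g q := by rw [h3, one_mul]

end ConvexReal

/-! ### The Legendre transform near `z₀`. -/

section Conjugate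

variable {a b : EReal} {f : ℝ → ℝ}

theorem isOpen_realIoo : IsOpen (realIoo a b) :=
  (isOpen_lt continuous_const continuous_coe_real_ereal).inter
    (isOpen_lt continuous_coe_real_ereal continuous_const)

theorem IsF1.one_mem (hf : IsF1 a b f) : (1 : ℝ) ∈ realIoo a b :=
  ⟨by simpa using hf.left_lt_one, by simpa using hf.one_lt_right⟩

theorem nonneg_of_mem_realIoo (ha : 0 ≤ a) {t : ℝ} (ht : t ∈ realIoo a b) : 0 ≤ t := by
  exact_mod_cast ha.trans ht.1.le

/-- `z₀` is a subgradient of `f` at `1`. -/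
theorem IsF1.zZero_mul_le (hf : IsF1 a b f) {t : ℝ} (ht : t ∈ realIoo a b) :
    zZero f * (t - 1) ≤ f t := by
  have h1 : (1 : ℝ) ∈ interior (realIoo a b) := by
    rw [isOpen_realIoo.interior_eq]; exact hf.one_mem
  rcases lt_trichotomy t 1 with h | rfl | h
  · have := le_rightDeriv_mul hf.convexOn ht h1 h
    rw [hf.map_one] at this
    unfold zZero
    linarith
  · simp [hf.map_one]
  · have := rightDeriv_mul_le hf.convexOn h1 ht h
    rw [hf.map_one] at this
    unfold zZero
    linarith

theorem le_conj {t : ℝ} (ht : t ∈ realIoo a b) (z : ℝ) :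
    ((z * t - f t : ℝ) : EReal) ≤ conj a b f z :=
  le_iSup₂ (f := fun t (_ : t ∈ realIoo a b) => ((z * t - f t : ℝ) : EReal)) t ht

theorem IsF1.self_le_conj (hf : IsF1 a b f) (z : ℝ) : (z : EReal) ≤ conj a b f z := by
  simpa [hf.map_one] using le_conj (f := f) hf.one_mem z

theorem IsF1.conj_ne_bot (hf : IsF1 a b f) (z : ℝ) : conj a b f z ≠ ⊥ := fun h => by
  have := hf.self_le_conj z
  rw [h, le_bot_iff] at this
  exact EReal.coe_ne_bot z this

theorem IsF1.coe_conjReal (hf : IsF1 a b f) {z : ℝ} (hz : z ∈ conjDomain a b f) :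
    (conjReal a b f z : EReal) = conj a b f z :=
  EReal.coe_toReal (ne_of_lt hz) (hf.conj_ne_bot z)

theorem IsF1.le_conjReal (hf : IsF1 a b f) {z t : ℝ} (hz : z ∈ conjDomain a b f)
    (ht : t ∈ realIoo a b) : z * t - f t ≤ conjReal a b f z := by
  have := le_conj (f := f) ht z
  rw [← hf.coe_conjReal hz] at this
  exact_mod_cast this

theorem conj_le_coe {z B : ℝ} (h : ∀ t ∈ realIoo a b, z * t - f t ≤ B) : conj a b f z ≤ B :=
  iSup₂_le fun t ht => by exact_mod_cast h t ht

theorem IsF1.conjReal_le (hf : IsF1 a b f) {z B : ℝ} (h : ∀ t ∈ realIoo a b, z * t - f t ≤ B) :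
    conjReal a b f z ≤ B := by
  have h1 := conj_le_coe h
  rw [← hf.coe_conjReal (h1.trans_lt (EReal.coe_lt_top B))] at h1
  exact_mod_cast h1

theorem IsF1.self_le_conjReal (hf : IsF1 a b f) {z : ℝ} (hz : z ∈ conjDomain a b f) :
    z ≤ conjReal a b f z := by
  simpa [hf.map_one] using hf.le_conjReal hz hf.one_mem

theorem conj_mono (ha : 0 ≤ a) : Monotone (conj a b f) := fun z w hzw =>
  iSup₂_le fun t ht => le_trans (by
    have := mul_le_mul_of_nonneg_right hzw (nonneg_of_mem_realIoo ha ht)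
    exact_mod_cast sub_le_sub_right this _) (le_conj ht w)

theorem conjReal_mono (hf : IsF1 a b f) (ha : 0 ≤ a) :
    MonotoneOn (conjReal a b f) (conjDomain a b f) := fun z hz w hw hzw => by
  have := conj_mono (f := f) (b := b) ha hzw
  rw [← hf.coe_conjReal hz, ← hf.coe_conjReal hw] at this
  exact_mod_cast this

theorem mem_conjDomain_of_le (ha : 0 ≤ a) {z w : ℝ} (hw : w ∈ conjDomain a b f) (h : z ≤ w) :
    z ∈ conjDomain a b f := (conj_mono ha h).trans_lt hw

theorem mem_interior_conjDomain_of_le (ha : 0 ≤ a) {z w : ℝ}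
    (hw : w ∈ interior (conjDomain a b f)) (h : z ≤ w) : z ∈ interior (conjDomain a b f) := by
  rw [mem_interior_iff_mem_nhds, Metric.mem_nhds_iff] at hw
  obtain ⟨r, hr, hball⟩ := hw
  -- Since `0 ≤ a`, `f^*` is monotone and its domain is a lower set; one domain point beyond `w`
  -- puts a whole half-line around `z` inside it.
  have hw' : w + r / 2 ∈ conjDomain a b f := hball (by simp [abs_of_pos hr, hr])
  exact interior_mono (s := Iic (w + r / 2)) (fun u hu => mem_conjDomain_of_le ha hw' hu)
    (by rw [interior_Iic]; simp only [mem_Iio]; linarith)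

theorem IsF1.convexOn_conjReal (hf : IsF1 a b f) (ha : 0 ≤ a) :
    ConvexOn ℝ (conjDomain a b f) (conjReal a b f) := by
  have hconn : OrdConnected (conjDomain a b f) :=
    ⟨fun x _ y hy z hz => mem_conjDomain_of_le ha hy hz.2⟩
  refine ⟨hconn.convex, fun x hx y hy p q hp hq hpq => hf.conjReal_le fun t ht => ?_⟩
  have h1 := mul_le_mul_of_nonneg_left (hf.le_conjReal hx ht) hp
  have h2 := mul_le_mul_of_nonneg_left (hf.le_conjReal hy ht) hq
  simp only [smul_eq_mul]
  have : f t = p * f t + q * f t := by rw [← add_mul, hpq, one_mul]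
  linarith

theorem IsF1.measurable_conjReal (ha : 0 ≤ a) : Measurable (conjReal a b f) :=
  measurable_ereal_toReal.comp (conj_mono ha).measurable

/-- `f^*` has slope at most `1` to the left of `z₀`. -/
theorem IsF1.conj_le_of_le_zZero (hf : IsF1 a b f) {z w : ℝ} (hz : z ∈ conjDomain a b f)
    (hzw : z ≤ w) (hw : w ≤ zZero f) : conj a b f w ≤ (conjReal a b f z + (w - z) : ℝ) := by
  refine conj_le_coe fun t ht => ?_
  -- For `t ≤ 1`, passing from `z` to `w` adds `(w - z) t ≤ w - z`. For `t ≥ 1`, the subgradient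
  -- inequality gives `w t - f t ≤ w + (w - z₀) (t - 1) ≤ w`, and `w ≤ f^*(z) + (w - z)` because `z
  -- ≤ f^*(z)`.
  rcases le_total t 1 with h | h
  · nlinarith [hf.le_conjReal hz ht]
  · nlinarith [hf.zZero_mul_le ht, hf.self_le_conjReal hz]

/-- `f^*` has slope at least `1` to the right of `z₀`. -/
theorem IsF1.le_conj_of_zZero_le (hf : IsF1 a b f) {z w : ℝ} (hw : w ∈ conjDomain a b f)
    (hzw : w ≤ z) (hw0 : zZero f ≤ w) :
    ((conjReal a b f w + (z - w) : ℝ) : EReal) ≤ conj a b f z := by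
  by_cases hz : z ∈ conjDomain a b f
  · rw [← hf.coe_conjReal hz, EReal.coe_le_coe_iff, ← le_sub_iff_add_le]
    refine hf.conjReal_le fun t ht => ?_
    -- The mirror image: `t ≥ 1` uses `(z - w) t ≥ z - w`, and `t ≤ 1` uses the subgradient at `1`
    -- together with `z ≤ f^*(z)`.
    rcases le_total 1 t with h | h
    · nlinarith [hf.le_conjReal hz ht]
    · nlinarith [hf.zZero_mul_le ht, hf.self_le_conjReal hz]
  · rw [show conj a b f z = ⊤ from not_lt_top_iff.1 hz]
    exact le_top

/-- The standing assumptions on `f` and the range of the test functions. -/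
structure Admissible (a b : EReal) (f : ℝ → ℝ) (α β : ℝ) : Prop where
  isF1 : IsF1 a b f
  nonneg : 0 ≤ a
  lt : α < β
  mem_interior : zZero f + β - α ∈ interior (conjDomain a b f)

variable {α β : ℝ}

theorem Admissible.mem_interior_of_le (h : Admissible a b f α β) {z : ℝ}
    (hz : z ≤ zZero f + β - α) : z ∈ interior (conjDomain a b f) :=
  mem_interior_conjDomain_of_le h.nonneg h.mem_interior hz

theorem Admissible.mem_of_le (h : Admissible a b f α β) {z : ℝ}
    (hz : z ≤ zZero f + β - α) : z ∈ conjDomain a b f :=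
  interior_subset (h.mem_interior_of_le hz)

/-- The subgradient inequality at `1` says that the supremum defining `f^*(z₀)` is attained at `t =
1`. -/
theorem Admissible.conjReal_zZero (h : Admissible a b f α β) :
    conjReal a b f (zZero f) = zZero f :=
  le_antisymm (h.isF1.conjReal_le fun t ht => by linarith [h.isF1.zZero_mul_le ht])
    (h.isF1.self_le_conjReal (h.mem_of_le (by linarith [h.lt])))

theorem Admissible.rightDeriv_mono (h : Admissible a b f α β) {z w : ℝ} (hzw : z ≤ w)
    (hw : w ≤ zZero f + β - α) :
    rightDeriv (conjReal a b f) z ≤ rightDeriv (conjReal a b f) w :=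
  (h.isF1.convexOn_conjReal h.nonneg).monotoneOn_rightDeriv
    (h.mem_interior_of_le (hzw.trans hw)) (h.mem_interior_of_le hw) hzw

theorem Admissible.conjReal_sub_le (h : Admissible a b f α β) {z w : ℝ} (hzw : z ≤ w)
    (hw : w ≤ zZero f + β - α) :
    conjReal a b f w - conjReal a b f z ≤ rightDeriv (conjReal a b f) w * (w - z) := by
  rcases hzw.eq_or_lt with rfl | hlt
  · simp
  · exact le_rightDeriv_mul (h.isF1.convexOn_conjReal h.nonneg) (h.mem_of_le (hzw.trans hw))
      (h.mem_interior_of_le hw) hlt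

theorem Admissible.le_conjReal_sub (h : Admissible a b f α β) {z w : ℝ} (hzw : z ≤ w)
    (hw : w ≤ zZero f + β - α) :
    rightDeriv (conjReal a b f) z * (w - z) ≤ conjReal a b f w - conjReal a b f z := by
  rcases hzw.eq_or_lt with rfl | hlt
  · simp
  · exact rightDeriv_mul_le (h.isF1.convexOn_conjReal h.nonneg)
      (h.mem_interior_of_le (hzw.trans hw)) (h.mem_of_le hw) hlt

/-- The slope bound `(f^*)'_+(β - α + z₀)`. -/
noncomputable abbrev maxSlope (a b : EReal) (f : ℝ → ℝ) (α β : ℝ) : ℝ :=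
  rightDeriv (conjReal a b f) (β - α + zZero f)

theorem Admissible.abs_conjReal_sub_le (h : Admissible a b f α β) {z w : ℝ}
    (hz : z ≤ zZero f + β - α) (hw : w ≤ zZero f + β - α) :
    |conjReal a b f z - conjReal a b f w| ≤ maxSlope a b f α β * |z - w| := by
  wlog hzw : z ≤ w generalizing z w
  · rw [abs_sub_comm, abs_sub_comm z w]
    exact this hw hz (le_of_not_ge hzw)
  have h1 := conjReal_mono h.isF1 h.nonneg (h.mem_of_le hz) (h.mem_of_le hw) hzw
  rw [abs_sub_comm, abs_of_nonneg (sub_nonneg.2 h1), abs_sub_comm, abs_of_nonneg (by linarith)]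
  refine (h.conjReal_sub_le hzw hw).trans (mul_le_mul_of_nonneg_right ?_ (by linarith))
  exact h.rightDeriv_mono (by linarith) (by linarith)

theorem Admissible.maxSlope_nonneg (h : Admissible a b f α β) : 0 ≤ maxSlope a b f α β := by
  have h1 := (abs_nonneg _).trans (h.abs_conjReal_sub_le (z := zZero f) (w := zZero f - 1)
    (by linarith [h.lt]) (by linarith [h.lt]))
  simpa using h1

theorem Admissible.conjReal_sub_le_of_le_zZero (h : Admissible a b f α β) {z w : ℝ} (hzw : z ≤ w)
    (hw : w ≤ zZero f) : conjReal a b f w - conjReal a b f z ≤ w - z := by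
  have := h.isF1.conj_le_of_le_zZero (h.mem_of_le (by linarith [h.lt])) hzw hw
  rw [← h.isF1.coe_conjReal (h.mem_of_le (by linarith [h.lt])), EReal.coe_le_coe_iff] at this
  linarith

theorem Admissible.le_conjReal_sub_of_zZero_le (h : Admissible a b f α β) {z w : ℝ} (hzw : w ≤ z)
    (hw : zZero f ≤ w) (hz : z ≤ zZero f + β - α) :
    z - w ≤ conjReal a b f z - conjReal a b f w := by
  have := h.isF1.le_conj_of_zZero_le (h.mem_of_le (hzw.trans hz)) hzw hw
  rw [← h.isF1.coe_conjReal (h.mem_of_le hz), EReal.coe_le_coe_iff] at this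
  linarith

theorem Admissible.rightDeriv_le_one (h : Admissible a b f α β) {z : ℝ} (hz : z < zZero f) :
    rightDeriv (conjReal a b f) z ≤ 1 := by
  have h1 := h.le_conjReal_sub hz.le (by linarith [h.lt])
  have h2 := h.conjReal_sub_le_of_le_zZero hz.le le_rfl
  nlinarith

theorem Admissible.one_le_rightDeriv (h : Admissible a b f α β) {z : ℝ} (hz : zZero f < z)
    (hz' : z ≤ zZero f + β - α) : 1 ≤ rightDeriv (conjReal a b f) z := by
  have h1 := h.conjReal_sub_le hz.le hz'
  have h2 := h.le_conjReal_sub_of_zZero_le hz.le le_rfl hz'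
  nlinarith

/-- If `(f^*)'_+` is Lipschitz then `(f^*)'_+(z₀) = 1`. -/
theorem Admissible.rightDeriv_zZero (h : Admissible a b f α β) {L : ℝ≥0}
    (hL : LipschitzOnWith L (rightDeriv (conjReal a b f))
      (Icc (zZero f - (β - α)) (zZero f + β - α))) :
    rightDeriv (conjReal a b f) (zZero f) = 1 := by
  have hlt := h.lt
  have hmem : zZero f ∈ Icc (zZero f - (β - α)) (zZero f + β - α) :=
    ⟨by linarith, by linarith⟩
  have hc := hL.continuousOn (zZero f) hmem
  -- The right derivative is at most `1` left of `z₀` and at least `1` right of it; continuity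
  -- passes both bounds to `z₀`.
  apply le_antisymm
  · have : (𝓝[Ioo (zZero f - (β - α)) (zZero f)] (zZero f)).NeBot :=
      right_nhdsWithin_Ioo_neBot (by linarith)
    refine le_of_tendsto (hc.mono_left (nhdsWithin_mono _ (s := Ioo (zZero f - (β - α)) (zZero f))
      fun z hz => ⟨hz.1.le, by linarith [hz.2]⟩)) ?_
    filter_upwards [self_mem_nhdsWithin] with z hz using h.rightDeriv_le_one hz.2
  · have : (𝓝[Ioo (zZero f) (zZero f + β - α)] (zZero f)).NeBot :=
      left_nhdsWithin_Ioo_neBot (by linarith)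
    refine ge_of_tendsto (hc.mono_left (nhdsWithin_mono _ (s := Ioo (zZero f) (zZero f + β - α))
      fun z hz => ⟨by linarith [hz.1], hz.2.le⟩)) ?_
    filter_upwards [self_mem_nhdsWithin] with z hz using h.one_le_rightDeriv hz.1 hz.2.le

/-- If `(f^*)'_+` is `L`-Lipschitz then `f^* - id` is `(β - α) L`-Lipschitz. -/
theorem Admissible.abs_conjReal_sub_self_le (h : Admissible a b f α β) {L : ℝ≥0}
    (hL : LipschitzOnWith L (rightDeriv (conjReal a b f))
      (Icc (zZero f - (β - α)) (zZero f + β - α))) {z w : ℝ}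
    (hz : z ∈ Icc (zZero f - (β - α)) (zZero f + β - α))
    (hw : w ∈ Icc (zZero f - (β - α)) (zZero f + β - α)) :
    |(conjReal a b f z - z) - (conjReal a b f w - w)| ≤ (β - α) * L * |z - w| := by
  wlog hzw : z ≤ w generalizing z w
  · rw [abs_sub_comm, abs_sub_comm z w]
    exact this hw hz (le_of_not_ge hzw)
  have hlt := h.lt
  -- The derivative equals `1` at `z₀`, and every point of the interval is within `β - α` of `z₀`.
  have hd : ∀ u ∈ Icc (zZero f - (β - α)) (zZero f + β - α),
      |rightDeriv (conjReal a b f) u - 1| ≤ (β - α) * L := fun u hu => by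
    have h1 := hL.dist_le_mul u hu (zZero f) ⟨by linarith, by linarith⟩
    rw [h.rightDeriv_zZero hL, Real.dist_eq, Real.dist_eq, mul_comm] at h1
    refine h1.trans (mul_le_mul_of_nonneg_right (abs_le.2 ⟨?_, ?_⟩) L.2)
    · linarith [hu.1]
    · linarith [hu.2]
  have h1 := h.conjReal_sub_le hzw hw.2
  have h2 := h.le_conjReal_sub hzw hw.2
  have h3 := mul_le_mul_of_nonneg_right (abs_le.1 (hd z hz)).1 (sub_nonneg.2 hzw)
  have h4 := mul_le_mul_of_nonneg_right (abs_le.1 (hd w hw)).2 (sub_nonneg.2 hzw)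
  rw [abs_sub_comm z w, abs_of_nonneg (sub_nonneg.2 hzw), abs_le]
  constructor <;> linarith

end Conjugate

/-! ### Extended-real expectations. -/

section Expectation

variable {S : Type*} [MeasurableSpace S]

theorem extExpect_mono (P : Measure S) {u v : S → EReal} (h : ∀ x, u x ≤ v x) :
    extExpect P u ≤ extExpect P v :=
  EReal.sub_le_sub
    (EReal.coe_ennreal_le_coe_ennreal_iff.2
      (lintegral_mono fun x => EReal.toENNReal_le_toENNReal (h x)))
    (EReal.coe_ennreal_le_coe_ennreal_iff.2
      (lintegral_mono fun x => EReal.toENNReal_le_toENNReal (EReal.neg_le_neg_iff.2 (h x))))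

theorem extExpect_coe (P : Measure S) {u : S → ℝ} (hu : Integrable u P) :
    extExpect P (fun x => (u x : EReal)) = (∫ x, u x ∂P : ℝ) := by
  have h1 : ∫⁻ x, ENNReal.ofReal (u x) ∂P ≠ ⊤ := hu.lintegral_lt_top.ne
  have h2 : ∫⁻ x, ENNReal.ofReal (-u x) ∂P ≠ ⊤ := hu.neg.lintegral_lt_top.ne
  unfold extExpect
  simp only [← EReal.coe_neg, EReal.real_coe_toENNReal]
  rw [integral_eq_lintegral_pos_part_sub_lintegral_neg_part hu, EReal.coe_sub,
    EReal.coe_ennreal_toReal h1, EReal.coe_ennreal_toReal h2]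

end Expectation

/-! ### The cumulant and the divergence of bounded test functions. -/

theorem coe_ciInf_eq {ι : Type*} [Nonempty ι] {u : ι → ℝ} {c : EReal}
    (h1 : ∀ i, c ≤ (u i : EReal)) (h2 : ((⨅ i, u i : ℝ) : EReal) ≤ c) :
    c = ((⨅ i, u i : ℝ) : EReal) := by
  refine le_antisymm ?_ h2
  induction c using EReal.rec with
  | bot => exact bot_le
  | coe c => exact EReal.coe_le_coe_iff.2 (le_ciInf fun i => EReal.coe_le_coe_iff.1 (h1 i))
  | top =>
    obtain ⟨i⟩ := ‹Nonempty ι›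
    exact absurd (top_le_iff.1 (h1 i)) (EReal.coe_ne_top _)

/-- A measurable test function with values in `[α, β]`. -/
structure IsTest {S : Type*} [MeasurableSpace S] (α β : ℝ) (h : S → ℝ) : Prop where
  measurable : Measurable h
  mem : ∀ x, h x ∈ Icc α β

/-- The range of shifts that suffices in the definition of `cumulant`. -/
abbrev Shift (f : ℝ → ℝ) (α β : ℝ) : Type := Icc (α - zZero f) (β - zZero f)

/-- The function minimized in `cumulant`. -/
noncomputable def shifted {S : Type*} [MeasurableSpace S] (a b : EReal) (f : ℝ → ℝ) (P : Measure S)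
    (h : S → ℝ) (ν : ℝ) : ℝ := ν + ∫ x, conjReal a b f (h x - ν) ∂P

/-- The real form of `cumulant`. -/
noncomputable def cumulantReal {S : Type*} [MeasurableSpace S] (a b : EReal) (f : ℝ → ℝ)
    (α β : ℝ) (P : Measure S) (h : S → ℝ) : ℝ :=
  ⨅ ν : Shift f α β, shifted a b f P h ν

section Cumulant

variable {a b : EReal} {f : ℝ → ℝ} {α β : ℝ} {S : Type*} [MeasurableSpace S]

theorem Admissible.nonempty_shift (H : Admissible a b f α β) : Nonempty (Shift f α β) :=
  ⟨⟨α - zZero f, le_rfl, by linarith [H.lt]⟩⟩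

theorem sub_mem_of_shift {y : ℝ} (hy : y ∈ Icc α β) (ν : Shift f α β) :
    y - ν ∈ Icc (zZero f - (β - α)) (zZero f + β - α) :=
  ⟨by linarith [hy.1, ν.2.2], by linarith [hy.2, ν.2.1]⟩

/-- A bound for `f^*` on the relevant interval. -/
noncomputable def conjBound (a b : EReal) (f : ℝ → ℝ) (α β : ℝ) : ℝ :=
  |zZero f - (β - α)| + |conjReal a b f (zZero f + β - α)|

theorem Admissible.abs_conjReal_le (H : Admissible a b f α β) {z : ℝ}
    (hz : z ∈ Icc (zZero f - (β - α)) (zZero f + β - α)) :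
    |conjReal a b f z| ≤ conjBound a b f α β := by
  have h1 := H.isF1.self_le_conjReal (H.mem_of_le hz.2)
  have h2 := conjReal_mono H.isF1 H.nonneg (H.mem_of_le hz.2) (H.mem_of_le le_rfl) hz.2
  unfold conjBound
  rw [abs_le]
  constructor
  · linarith [neg_abs_le (zZero f - (β - α)), abs_nonneg (conjReal a b f (zZero f + β - α)), hz.1]
  · linarith [le_abs_self (conjReal a b f (zZero f + β - α)), abs_nonneg (zZero f - (β - α))]

variable {P : Measure S} {h h' : S → ℝ}

theorem IsTest.abs_apply_le (hh : IsTest α β h) (x : S) : |h x| ≤ max |α| |β| :=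
  abs_le_max_abs_abs (hh.mem x).1 (hh.mem x).2

theorem IsTest.integrable [IsFiniteMeasure P] (hh : IsTest α β h) : Integrable h P :=
  integrable_of_abs_le hh.measurable hh.abs_apply_le

theorem IsTest.integral_mem [IsProbabilityMeasure P] (hh : IsTest α β h) :
    ∫ x, h x ∂P ∈ Icc α β :=
  ⟨by simpa using integral_mono (μ := P) (integrable_const α) hh.integrable fun x => (hh.mem x).1,
    by simpa using integral_mono (μ := P) hh.integrable (integrable_const β) fun x => (hh.mem x).2⟩

theorem IsTest.measurable_conjReal (H : Admissible a b f α β) (hh : IsTest α β h) (ν : ℝ) :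
    Measurable fun x => conjReal a b f (h x - ν) :=
  (IsF1.measurable_conjReal H.nonneg).comp (hh.measurable.sub_const _)

theorem IsTest.integrable_conjReal [IsFiniteMeasure P] (H : Admissible a b f α β)
    (hh : IsTest α β h) (ν : Shift f α β) : Integrable (fun x => conjReal a b f (h x - ν)) P :=
  integrable_of_abs_le (hh.measurable_conjReal H ν)
    fun x => H.abs_conjReal_le (sub_mem_of_shift (hh.mem x) ν)

variable [IsProbabilityMeasure P]

theorem IsTest.integral_le_shifted (H : Admissible a b f α β) (hh : IsTest α β h)
    (ν : Shift f α β) : ∫ x, h x ∂P ≤ shifted a b f P h ν := by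
  have h1 : ∫ x, (h x - ν) ∂P ≤ ∫ x, conjReal a b f (h x - ν) ∂P :=
    integral_mono (hh.integrable.sub (integrable_const _)) (hh.integrable_conjReal H ν) fun x =>
      H.isF1.self_le_conjReal (H.mem_of_le (sub_mem_of_shift (hh.mem x) ν).2)
  rw [integral_sub hh.integrable (integrable_const _)] at h1
  simp only [integral_const, probReal_univ, one_smul] at h1
  unfold shifted
  linarith

theorem IsTest.bddBelow (H : Admissible a b f α β) (hh : IsTest α β h) :
    BddBelow (range fun ν : Shift f α β => shifted a b f P h ν) :=
  ⟨∫ x, h x ∂P, by rintro _ ⟨ν, rfl⟩; exact hh.integral_le_shifted H ν⟩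

theorem IsTest.cumulantReal_le (H : Admissible a b f α β) (hh : IsTest α β h) (ν : Shift f α β) :
    cumulantReal a b f α β P h ≤ shifted a b f P h ν :=
  ciInf_le (hh.bddBelow H) ν

theorem IsTest.integral_le_cumulantReal (H : Admissible a b f α β) (hh : IsTest α β h) :
    ∫ x, h x ∂P ≤ cumulantReal a b f α β P h :=
  have := H.nonempty_shift
  le_ciInf fun ν => hh.integral_le_shifted H ν

theorem IsTest.cumulantReal_mem (H : Admissible a b f α β) (hh : IsTest α β h) :
    cumulantReal a b f α β P h ∈ Icc α β := by
  refine ⟨(hh.integral_mem (P := P)).1.trans (hh.integral_le_cumulantReal H), ?_⟩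
  -- With this shift all arguments are at most `z₀`, where `f^* ≤ f^*(z₀) = z₀`, so the objective is
  -- at most `β`.
  let ν : Shift f α β := ⟨β - zZero f, by linarith [H.lt], le_rfl⟩
  refine (hh.cumulantReal_le H ν).trans ?_
  have h1 : ∫ x, conjReal a b f (h x - ν) ∂P ≤ ∫ _, zZero f ∂P := by
    refine integral_mono (hh.integrable_conjReal H ν) (integrable_const _) fun x => ?_
    have h2 : h x - ν ≤ zZero f := by simp only [ν]; linarith [(hh.mem x).2]
    have h3 : zZero f ≤ zZero f + β - α := by linarith [H.lt]
    exact (conjReal_mono H.isF1 H.nonneg (H.mem_of_le (h2.trans h3)) (H.mem_of_le h3) h2).trans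
      H.conjReal_zZero.le
  simp only [integral_const, probReal_univ, one_smul] at h1
  unfold shifted
  simp only [ν] at h1 ⊢
  linarith

theorem IsTest.abs_shifted_sub_le (H : Admissible a b f α β) (hh : IsTest α β h)
    (hh' : IsTest α β h') (ν ν' : Shift f α β) :
    |shifted a b f P h ν - shifted a b f P h' ν'|
      ≤ (1 + maxSlope a b f α β) * |(ν : ℝ) - ν'|
        + maxSlope a b f α β * ∫ x, |h x - h' x| ∂P := by
  have hint : Integrable (fun x => |h x - h' x|) P := (hh.integrable.sub hh'.integrable).abs
  have h1 : |∫ x, (conjReal a b f (h x - ν) - conjReal a b f (h' x - ν')) ∂P|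
      ≤ ∫ x, maxSlope a b f α β * (|h x - h' x| + |(ν : ℝ) - ν'|) ∂P := by
    refine (abs_integral_le_integral_abs).trans (integral_mono
      ((hh.integrable_conjReal H ν).sub (hh'.integrable_conjReal H ν')).abs
      ((hint.add (integrable_const _)).const_mul _) fun x => ?_)
    refine (H.abs_conjReal_sub_le (sub_mem_of_shift (hh.mem x) ν).2
      (sub_mem_of_shift (hh'.mem x) ν').2).trans
      (mul_le_mul_of_nonneg_left ?_ H.maxSlope_nonneg)
    rw [show h x - ν - (h' x - ν') = (h x - h' x) - ((ν : ℝ) - ν') by ring]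
    exact abs_sub _ _
  rw [integral_sub (hh.integrable_conjReal H ν) (hh'.integrable_conjReal H ν'),
    integral_const_mul, integral_add hint (integrable_const _)] at h1
  simp only [integral_const, probReal_univ, one_smul] at h1
  unfold shifted
  rw [add_sub_add_comm]
  refine (abs_add_le _ _).trans ?_
  linarith

theorem IsTest.continuous_shifted (H : Admissible a b f α β) (hh : IsTest α β h) :
    Continuous fun ν : Shift f α β => shifted a b f P h ν := by
  refine (LipschitzWith.of_dist_le_mul (K := ⟨1 + maxSlope a b f α β, ?_⟩) fun ν ν' => ?_).continuous
  · linarith [H.maxSlope_nonneg]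
  · have := hh.abs_shifted_sub_le (P := P) H hh ν ν'
    simp only [sub_self, abs_zero, integral_zero, mul_zero, add_zero] at this
    exact this

theorem IsTest.abs_cumulantReal_sub_le (H : Admissible a b f α β) (hh : IsTest α β h)
    (hh' : IsTest α β h') :
    |cumulantReal a b f α β P h - cumulantReal a b f α β P h'|
      ≤ maxSlope a b f α β * ∫ x, |h x - h' x| ∂P := by
  have := H.nonempty_shift
  have key : ∀ {u v : S → ℝ}, IsTest α β u → IsTest α β v →
      cumulantReal a b f α β P u - maxSlope a b f α β * ∫ x, |u x - v x| ∂P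
        ≤ cumulantReal a b f α β P v := fun {u v} hu hv => le_ciInf fun ν => by
    have h1 := hu.cumulantReal_le (P := P) H ν
    have h2 := (abs_le.1 (hu.abs_shifted_sub_le (P := P) H hv ν ν)).2
    simp only [sub_self, abs_zero, mul_zero, zero_add] at h2
    linarith
  have h1 := key hh hh'
  have h2 := key hh' hh
  simp only [abs_sub_comm (h' _)] at h2
  rw [abs_le]
  constructor <;> linarith

/-- A dense sequence of shifts. -/
noncomputable def shiftSeq (H : Admissible a b f α β) (j : ℕ) : Shift f α β :=
  have := H.nonempty_shift
  TopologicalSpace.denseSeq (Shift f α β) j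

/-- By continuity in the shift a dense sequence suffices. This gives measurability in the sample and
a countable index set for symmetrization. -/
theorem IsTest.cumulantReal_eq_ciInf (H : Admissible a b f α β) (hh : IsTest α β h) :
    cumulantReal a b f α β P h = ⨅ j, shifted a b f P h (shiftSeq H j) := by
  have := H.nonempty_shift
  refine le_antisymm (le_ciInf fun j => hh.cumulantReal_le H _) (le_ciInf fun ν => ?_)
  refine (TopologicalSpace.denseRange_denseSeq (Shift f α β)).induction_on
    (p := fun ν => ⨅ j, shifted a b f P h (shiftSeq H j) ≤ shifted a b f P h ν) ν
    (isClosed_le continuous_const (hh.continuous_shifted H)) fun j => ?_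
  exact ciInf_le (f := fun j => shifted a b f P h (shiftSeq H j))
    ((hh.bddBelow H).mono (by rintro _ ⟨j, rfl⟩; exact ⟨shiftSeq H j, rfl⟩)) j

/-- If `ν < α - z₀`, both `h - ν` and `h - (α - z₀)` lie right of `z₀`, where the slope of `f^*` is
at least `1`: raising `ν` to `α - z₀` lowers the expectation by at least the increase of `ν`, even
where `f^*` is infinite. If `ν > β - z₀`, the slope is at most `1` and lowering `ν` to `β - z₀`
costs nothing. -/
theorem IsTest.cumulant_eq (H : Admissible a b f α β) (hh : IsTest α β h) :
    cumulant a b f P h = (cumulantReal a b f α β P h : EReal) := by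
  have := H.nonempty_shift
  have hlt := H.lt
  have hval : ∀ ν : Shift f α β, ((ν : ℝ) : EReal)
      + extExpect P (fun x => conj a b f (h x - ν)) = (shifted a b f P h ν : EReal) := fun ν => by
    have : (fun x => conj a b f (h x - ν)) = fun x => (conjReal a b f (h x - ν) : EReal) :=
      funext fun x => (H.isF1.coe_conjReal (H.mem_of_le (sub_mem_of_shift (hh.mem x) ν).2)).symm
    rw [this, extExpect_coe P (hh.integrable_conjReal H ν)]
    rfl
  have hshift : ∀ (ν : ℝ) (ν' : Shift f α β),
      (∀ x, ((conjReal a b f (h x - ν') + (ν' - ν) : ℝ) : EReal) ≤ conj a b f (h x - ν)) →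
      (cumulantReal a b f α β P h : EReal)
        ≤ (ν : EReal) + extExpect P (fun x => conj a b f (h x - ν)) := fun ν ν' hle => by
    have h1 := extExpect_mono P hle
    have hi := hh.integrable_conjReal (P := P) H ν'
    rw [extExpect_coe P (u := fun x => conjReal a b f (h x - ν') + (ν' - ν))
      (hi.add (integrable_const _)), integral_add hi (integrable_const _)] at h1
    refine le_trans ?_ (add_le_add_right h1 (ν : EReal))
    rw [← EReal.coe_add, EReal.coe_le_coe_iff]
    refine (hh.cumulantReal_le H ν').trans (le_of_eq ?_)
    simp only [shifted, integral_const, probReal_univ, one_smul]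
    ring
  refine coe_ciInf_eq (fun ν => (iInf_le _ (ν : ℝ)).trans (hval ν).le)
    (le_iInf fun ν => ?_)
  change (cumulantReal a b f α β P h : EReal) ≤ _
  rcases lt_or_ge ν (α - zZero f) with h1 | h1
  · refine hshift ν ⟨α - zZero f, le_rfl, by linarith⟩ fun x => ?_
    have h2 := hh.mem x
    have := H.isF1.le_conj_of_zZero_le (z := h x - ν) (w := h x - (α - zZero f))
      (H.mem_of_le (by linarith [h2.2])) (by linarith) (by linarith [h2.1])
    rwa [show h x - ν - (h x - (α - zZero f)) = α - zZero f - ν by ring] at this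
  rcases le_or_gt ν (β - zZero f) with h3 | h3
  · exact (EReal.coe_le_coe_iff.2 (hh.cumulantReal_le H ⟨ν, h1, h3⟩)).trans (hval ⟨ν, h1, h3⟩).ge
  · refine hshift ν ⟨β - zZero f, by linarith, le_rfl⟩ fun x => ?_
    have h2 := hh.mem x
    have hz : h x - ν ≤ zZero f := by linarith [h2.2]
    have hw : h x - (β - zZero f) ≤ zZero f := by linarith [h2.2]
    rw [← H.isF1.coe_conjReal (H.mem_of_le (by linarith)), EReal.coe_le_coe_iff]
    have := H.conjReal_sub_le_of_le_zZero (z := h x - ν) (w := h x - (β - zZero f))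
      (by linarith) hw
    simp only
    linarith

/-- The objective of the divergence at a test function. -/
noncomputable def gain (a b : EReal) (f : ℝ → ℝ) (α β : ℝ) (Q P : Measure S) (h : S → ℝ) : ℝ :=
  ∫ x, h x ∂Q - cumulantReal a b f α β P h

variable {Q : Measure S} [IsProbabilityMeasure Q]

theorem IsTest.abs_gain_le (H : Admissible a b f α β) (hh : IsTest α β h) :
    |gain a b f α β Q P h| ≤ β - α := by
  have h1 := hh.integral_mem (P := Q)
  have h2 := hh.cumulantReal_mem (P := P) H
  unfold gain
  rw [abs_le]
  constructor <;> linarith [h1.1, h1.2, h2.1, h2.2]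

/-- Bounded pointwise convergence implies convergence in `L¹(P)`, for which the cumulant is
Lipschitz. This is what allows the class to be replaced by a pointwise dense sequence. -/
theorem IsTest.tendsto_gain (H : Admissible a b f α β) {u : ℕ → S → ℝ}
    (hu : ∀ j, IsTest α β (u j)) (hh : IsTest α β h)
    (hlim : ∀ x, Tendsto (fun j => u j x) atTop (𝓝 (h x))) :
    Tendsto (fun j => gain a b f α β Q P (u j)) atTop (𝓝 (gain a b f α β Q P h)) := by
  refine Tendsto.sub ?_ ?_
  · exact tendsto_integral_of_dominated_convergence (fun _ => max |α| |β|)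
      (fun j => (hu j).measurable.aestronglyMeasurable) (integrable_const _)
      (fun j => .of_forall (hu j).abs_apply_le) (.of_forall hlim)
  · have h1 : Tendsto (fun j => ∫ x, |u j x - h x| ∂P) atTop (𝓝 (∫ _, (0 : ℝ) ∂P)) := by
      refine tendsto_integral_of_dominated_convergence (fun _ => max |α| |β| + max |α| |β|)
        (fun j => ((hu j).measurable.sub hh.measurable).abs.aestronglyMeasurable)
        (integrable_const _) (fun j => .of_forall fun x => ?_) (.of_forall fun x => ?_)
      · rw [Real.norm_eq_abs, abs_abs]
        exact (abs_sub _ _).trans (add_le_add ((hu j).abs_apply_le x) (hh.abs_apply_le x))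
      · simpa using ((hlim x).sub_const (h x)).abs
    rw [integral_zero] at h1
    rw [tendsto_iff_dist_tendsto_zero]
    refine squeeze_zero (fun _ => dist_nonneg)
      (fun j => (hu j).abs_cumulantReal_sub_le (P := P) H hh) ?_
    simpa using h1.const_mul (maxSlope a b f α β)

/-- The divergence as a supremum over a sequence that is pointwise dense in the class. -/
theorem divergence_eq (H : Admissible a b f α β) {Γ : Set (S → ℝ)} (hΓ : ∀ h ∈ Γ, IsTest α β h)
    {g : ℕ → S → ℝ} (hg : ∀ k, g k ∈ Γ)
    (hlim : ∀ h ∈ Γ, ∃ u : ℕ → S → ℝ, (∀ j, u j ∈ range g) ∧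
      ∀ x, Tendsto (fun j => u j x) atTop (𝓝 (h x))) :
    divergence a b f Γ Q P = ((⨆ k, gain a b f α β Q P (g k) : ℝ) : EReal) := by
  have hval : ∀ h ∈ Γ, ((∫ x, h x ∂Q : ℝ) : EReal) - cumulant a b f P h
      = (gain a b f α β Q P h : EReal) := fun h hh => by
    rw [(hΓ h hh).cumulant_eq H, ← EReal.coe_sub]
    rfl
  have hbdd : BddAbove (range fun k => gain a b f α β Q P (g k)) :=
    bddAbove_range_of_abs_le fun k => (hΓ _ (hg k)).abs_gain_le H
  refine le_antisymm (iSup₂_le fun h hh => ?_) ?_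
  · rw [hval h hh, EReal.coe_le_coe_iff]
    obtain ⟨u, hu, hl⟩ := hlim h hh
    refine le_of_tendsto (IsTest.tendsto_gain H (fun j => ?_) (hΓ h hh) hl)
      (.of_forall fun j => ?_)
    · obtain ⟨k, hk⟩ := hu j
      rw [← hk]
      exact hΓ _ (hg k)
    · obtain ⟨k, hk⟩ := hu j
      rw [← hk]
      exact le_ciSup hbdd k
  · have hle : ∀ k, ((gain a b f α β Q P (g k) : ℝ) : EReal) ≤ divergence a b f Γ Q P := fun k => by
      rw [← hval _ (hg k)]
      exact le_iSup₂ (f := fun h (_ : h ∈ Γ) =>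
        ((∫ x, h x ∂Q : ℝ) : EReal) - cumulant a b f P h) _ (hg k)
    induction hD : divergence a b f Γ Q P using EReal.rec with
    | bot => exact absurd (le_bot_iff.1 (hD ▸ hle 0)) (EReal.coe_ne_bot _)
    | coe d => exact EReal.coe_le_coe_iff.2 (ciSup_le fun k =>
        EReal.coe_le_coe_iff.1 (hD ▸ hle k))
    | top => exact le_top

/-- The empirical Rademacher complexity as a supremum over a pointwise dense sequence. -/
theorem empRademacher_eq {Γ : Set (S → ℝ)} (hΓ : ∀ h ∈ Γ, IsTest α β h)
    {g : ℕ → S → ℝ} (hg : ∀ k, g k ∈ Γ)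
    (hlim : ∀ h ∈ Γ, ∃ u : ℕ → S → ℝ, (∀ j, u j ∈ range g) ∧
      ∀ x, Tendsto (fun j => u j x) atTop (𝓝 (h x))) {n : ℕ} (y : Fin n → S) :
    empRademacher Γ y = radMean fun i k => g k (y i) := by
  have hC : 0 ≤ max |α| |β| := le_max_of_le_left (abs_nonneg _)
  have hb : ∀ (σ : Fin n → ℤˣ) (h : Γ),
      |(1 / n : ℝ) * ∑ i, sgn (σ i) * (h : S → ℝ) (y i)| ≤ max |α| |β| := fun σ h =>
    abs_signed_mean_le σ hC fun i => (hΓ h h.2).abs_apply_le _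
  have hne : Nonempty Γ := ⟨⟨_, hg 0⟩⟩
  unfold empRademacher radMean
  congr 1
  refine Finset.sum_congr rfl fun σ _ => le_antisymm (ciSup_le fun h => ?_) (ciSup_le fun k => ?_)
  · obtain ⟨u, hu, hl⟩ := hlim h h.2
    refine le_of_tendsto ((tendsto_finsetSum _ fun i _ =>
      (hl (y i)).const_mul (sgn (σ i))).const_mul (1 / n : ℝ)) (.of_forall fun j => ?_)
    obtain ⟨k, hk⟩ := hu j
    rw [← hk]
    exact le_ciSup (f := fun k => (1 / n : ℝ) * ∑ i, sgn (σ i) * g k (y i))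
      (bddAbove_range_of_abs_le fun k => hb σ ⟨_, hg k⟩) k
  · exact le_ciSup (f := fun h : Γ => (1 / n : ℝ) * ∑ i, sgn (σ i) * (h : S → ℝ) (y i))
      (bddAbove_range_of_abs_le (hb σ)) ⟨_, hg k⟩

theorem isProbabilityMeasure_empiricalMeasure {n : ℕ} (hn : 0 < n) (x : Fin n → S) :
    IsProbabilityMeasure (empiricalMeasure x) := ⟨by
  have : (n : ℝ≥0∞) ≠ 0 := by exact_mod_cast hn.ne'
  simp [empiricalMeasure, ENNReal.inv_mul_cancel this (ENNReal.natCast_ne_top n)]⟩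

theorem integral_empiricalMeasure {n : ℕ} (x : Fin n → S) {u : S → ℝ} (hu : Measurable u) {C : ℝ}
    (hC : ∀ x, |u x| ≤ C) :
    ∫ z, u z ∂(empiricalMeasure x) = (1 / n : ℝ) * ∑ i, u (x i) := by
  unfold empiricalMeasure
  rw [integral_smul_measure, integral_finsetSum_measure fun i _ => integrable_of_abs_le hu hC]
  simp [integral_dirac' u _ hu.stronglyMeasurable]

end Cumulant

/-! ### Bounded differences of the empirical divergence. -/

section Sample

variable {a b : EReal} {f : ℝ → ℝ} {α β : ℝ} {S : Type*} [MeasurableSpace S]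

theorem IsTest.shifted_empiricalMeasure (H : Admissible a b f α β) {h : S → ℝ} (hh : IsTest α β h)
    (ν : Shift f α β) {m : ℕ} (y : Fin m → S) :
    shifted a b f (empiricalMeasure y) h ν
      = ν + (1 / m : ℝ) * ∑ i, conjReal a b f (h (y i) - ν) := by
  unfold shifted
  rw [integral_empiricalMeasure y (hh.measurable_conjReal H ν)
    fun x => H.abs_conjReal_le (sub_mem_of_shift (hh.mem x) ν)]

theorem IsTest.measurable_cumulantReal (H : Admissible a b f α β) {h : S → ℝ}
    (hh : IsTest α β h) {m : ℕ} (hm : 0 < m) :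
    Measurable fun y : Fin m → S => cumulantReal a b f α β (empiricalMeasure y) h := by
  have : (fun y : Fin m → S => cumulantReal a b f α β (empiricalMeasure y) h)
      = fun y => ⨅ j, ((shiftSeq H j : ℝ)
        + (1 / m : ℝ) * ∑ i, conjReal a b f (h (y i) - shiftSeq H j)) := funext fun y => by
    have := isProbabilityMeasure_empiricalMeasure hm y
    rw [hh.cumulantReal_eq_ciInf H]
    exact iInf_congr fun j => hh.shifted_empiricalMeasure H _ y
  rw [this]
  exact Measurable.iInf fun j => ((Finset.measurable_sum _ fun i _ =>
    (hh.measurable_conjReal H _).comp (measurable_pi_apply i)).const_mul _).const_add _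

/-- `(u, ν) ↦ f^*(u - ν)` is submodular. -/
theorem Admissible.conjReal_submodular (H : Admissible a b f α β) {u w : ℝ} (hu : u ∈ Icc α β)
    (hw : w ∈ Icc α β) (ν ν' : Shift f α β) :
    conjReal a b f (max u w - max (ν : ℝ) ν') + conjReal a b f (min u w - min (ν : ℝ) ν')
      ≤ conjReal a b f (u - ν) + conjReal a b f (w - ν') := by
  have hc := H.isF1.convexOn_conjReal H.nonneg
  have h1 := H.mem_of_le (sub_mem_of_shift hu ν).2
  have h2 := H.mem_of_le (sub_mem_of_shift hw ν').2
  rcases le_total u w with h | h <;> rcases le_total (ν : ℝ) ν' with h' | h' <;>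
    simp only [max_eq_left, max_eq_right, min_eq_left, min_eq_right, h, h']
  · linarith
  · exact convexOn_add_le_add hc h1 h2 (by linarith) (by linarith) (by ring)
  · linarith [convexOn_add_le_add hc h2 h1 (u := u - ν') (v := w - ν) (by linarith) (by linarith)
      (by ring)]
  · linarith

/-- Changing one sample point changes the empirical cumulant by at most `Δ / m`. -/
theorem IsTest.cumulantReal_sub_le (H : Admissible a b f α β) {h : S → ℝ} (hh : IsTest α β h)
    {m : ℕ} (hm : 0 < m) (i : Fin m) (y y' : Fin m → S) (hy : ∀ j, j ≠ i → y j = y' j) :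
    cumulantReal a b f α β (empiricalMeasure y) h - cumulantReal a b f α β (empiricalMeasure y') h
      ≤ 1 / m * delta a b f α β m := by
  have hlt := H.lt
  have hmR : (0 : ℝ) < m := by exact_mod_cast hm
  have hne := H.nonempty_shift
  have := isProbabilityMeasure_empiricalMeasure hm y
  have := isProbabilityMeasure_empiricalMeasure hm y'
  rw [one_div, ← div_eq_inv_mul, le_div_iff₀' hmR]
  refine le_csInf ⟨_, mem_image_of_mem _ (right_mem_Icc.2 (by linarith))⟩ ?_
  rintro _ ⟨z, hz, rfl⟩
  refine mul_le_mul_of_nonneg_left ?_ hmR.le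
  rw [sub_le_comm]
  refine le_ciInf fun ν => ?_
  -- The variable `z` of `Δ` corresponds to the shift `α - z`, so that `α - ν' = z` and `β - ν' = β
  -- - α + z`.
  let ν' : Shift f α β := ⟨α - z, by linarith [hz.2], by linarith [hz.1]⟩
  let νmax : Shift f α β := max ν ν'
  have hmax : (νmax : ℝ) = max (ν : ℝ) ν' := (Subtype.mono_coe _).map_max
  -- The fictitious sample: its objective at `ν'`, minus `α`, is the bracket in the definition of
  -- `Δ`.
  let w : Fin m → ℝ := fun j => if j = i then β else α
  have hw : ∀ j, w j ∈ Icc α β := fun j => by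
    simp only [w]; split_ifs <;> simp [hlt.le]
  -- Submodularity for the pairs `(h (y' j), ν)` and `(w j, ν')`. The maximum of the two values
  -- dominates `h (y j)`, also at the changed point, where `w i = β`. The minimum term is bounded
  -- below through `u ≤ f^*(u)` and `α ≤ min`.
  have hterm : ∀ j, conjReal a b f (h (y j) - νmax) + (α - min (ν : ℝ) ν')
      ≤ conjReal a b f (h (y' j) - ν) + conjReal a b f (w j - ν') := fun j => by
    refine le_trans (add_le_add ?_ ?_) (H.conjReal_submodular (hh.mem (y' j)) (hw j) ν ν')
    · rw [← hmax]
      have hle : h (y j) ≤ max (h (y' j)) (w j) := by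
        by_cases hj : j = i
        · exact le_max_of_le_right (by simpa [w, hj] using (hh.mem (y i)).2)
        · exact le_max_of_le_left (by rw [hy j hj])
      have hmem : max (h (y' j)) (w j) ∈ Icc α β :=
        ⟨le_max_of_le_right (hw j).1, max_le (hh.mem _).2 (hw j).2⟩
      exact conjReal_mono H.isF1 H.nonneg (H.mem_of_le (sub_mem_of_shift (hh.mem _) νmax).2)
        (H.mem_of_le (sub_mem_of_shift hmem νmax).2) (by linarith)
    · have hmem : min (h (y' j)) (w j) ∈ Icc α β :=
        ⟨le_min (hh.mem _).1 (hw j).1, min_le_of_right_le (hw j).2⟩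
      have hmin : ((min ν ν' : Shift f α β) : ℝ) = min (ν : ℝ) ν' := (Subtype.mono_coe _).map_min
      refine le_trans ?_ (H.isF1.self_le_conjReal (H.mem_of_le ?_))
      · linarith [hmem.1]
      · rw [← hmin]
        exact (sub_mem_of_shift hmem _).2
  have hsum := Finset.sum_le_sum fun j (_ : j ∈ Finset.univ) => hterm j
  simp only [Finset.sum_add_distrib] at hsum
  have hwsum : ∑ j, conjReal a b f (w j - ν') = (m - 1) * conjReal a b f z
      + conjReal a b f (β - α + z) := by
    rw [← Finset.add_sum_erase _ _ (Finset.mem_univ i), add_comm]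
    congr 1
    · rw [Finset.sum_congr rfl fun j hj => by
        rw [show w j = α from if_neg (Finset.ne_of_mem_erase hj)]]
      simp only [ν', sub_sub_cancel, Finset.sum_const, Finset.card_erase_of_mem (Finset.mem_univ i),
        Finset.card_univ, Fintype.card_fin, nsmul_eq_mul]
      rw [Nat.cast_sub hm, Nat.cast_one]
    · simp only [w, ν', if_true]
      congr 1
      ring
  rw [hwsum] at hsum
  simp only [Finset.sum_const, Finset.card_univ, Fintype.card_fin, nsmul_eq_mul] at hsum
  have h1 := hh.cumulantReal_le (P := empiricalMeasure y) H νmax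
  rw [hh.shifted_empiricalMeasure H] at h1
  rw [hh.shifted_empiricalMeasure H]
  -- The maximum of the shifts enters as the trial shift for `y`, the minimum through the lower
  -- bound in `hterm`; together they restore `ν + ν'`.
  have hmm : (νmax : ℝ) + min (ν : ℝ) ν' = ν + ν' := by rw [hmax]; exact max_add_min _ _
  have hν' : (ν' : ℝ) = α - z := rfl
  have h2 := mul_le_mul_of_nonneg_left hsum (by positivity : (0 : ℝ) ≤ 1 / m)
  have h3 : (1 / m : ℝ) * (m * (α - min (ν : ℝ) ν')) = α - min (ν : ℝ) ν' := by field_simp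
  have h4 : (1 / m : ℝ) * ((m - 1) * conjReal a b f z)
      = (m - 1) / m * conjReal a b f z := by ring
  rw [mul_add, mul_add, mul_add, h3, h4] at h2
  linarith

/-- The empirical divergence as a function of the joint sample. -/
noncomputable def sampleDivergence (a b : EReal) (f : ℝ → ℝ) (α β : ℝ) (g : ℕ → S → ℝ) {n m : ℕ}
    (z : Fin n ⊕ Fin m → S) : ℝ :=
  ⨆ k, gain a b f α β (empiricalMeasure fun i => z (Sum.inl i))
    (empiricalMeasure fun i => z (Sum.inr i)) (g k)

variable {g : ℕ → S → ℝ} {n m : ℕ}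

theorem IsTest.gain_empiricalMeasure {h : S → ℝ} (hh : IsTest α β h) (x : Fin n → S)
    (P : Measure S) : gain a b f α β (empiricalMeasure x) P h
      = (1 / n : ℝ) * ∑ i, h (x i) - cumulantReal a b f α β P h := by
  unfold gain
  rw [integral_empiricalMeasure x hh.measurable hh.abs_apply_le]

theorem measurable_sampleDivergence (H : Admissible a b f α β) (hg : ∀ k, IsTest α β (g k))
    (hm : 0 < m) :
    Measurable fun z : Fin n ⊕ Fin m → S => sampleDivergence a b f α β g z := by
  unfold sampleDivergence
  refine Measurable.iSup fun k => ?_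
  simp only [(hg k).gain_empiricalMeasure]
  refine Measurable.sub ?_ ?_
  · exact (Finset.measurable_sum _ fun i _ =>
      (hg k).measurable.comp (measurable_pi_apply _)).const_mul _
  · exact ((hg k).measurable_cumulantReal H hm).comp
      (measurable_pi_lambda _ fun i => measurable_pi_apply _)

theorem abs_gain_sample_le (H : Admissible a b f α β) (hg : ∀ k, IsTest α β (g k)) (hn : 0 < n)
    (hm : 0 < m) (z : Fin n ⊕ Fin m → S) (k : ℕ) :
    |gain a b f α β (empiricalMeasure fun i => z (Sum.inl i))
      (empiricalMeasure fun i => z (Sum.inr i)) (g k)| ≤ β - α := by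
  have := isProbabilityMeasure_empiricalMeasure hn fun i => z (Sum.inl i)
  have := isProbabilityMeasure_empiricalMeasure hm fun i => z (Sum.inr i)
  exact (hg k).abs_gain_le H

theorem abs_sampleDivergence_le (H : Admissible a b f α β) (hg : ∀ k, IsTest α β (g k))
    (hn : 0 < n) (hm : 0 < m) (z : Fin n ⊕ Fin m → S) :
    |sampleDivergence a b f α β g z| ≤ β - α :=
  abs_ciSup_le fun k => abs_gain_sample_le H hg hn hm z k

/-- The bounded differences of the empirical divergence. -/
noncomputable def sampleOsc (a b : EReal) (f : ℝ → ℝ) (α β : ℝ) (n m : ℕ) : Fin n ⊕ Fin m → ℝ :=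
  Sum.elim (fun _ => 1 / n * (β - α)) (fun _ => 1 / m * delta a b f α β m)

theorem sum_sampleOsc_sq (hn : 0 < n) (hm : 0 < m) : ∑ i, sampleOsc a b f α β n m i ^ 2
    = 1 / n * (β - α) ^ 2 + 1 / m * delta a b f α β m ^ 2 := by
  have : (n : ℝ) ≠ 0 := by exact_mod_cast hn.ne'
  have : (m : ℝ) ≠ 0 := by exact_mod_cast hm.ne'
  simp only [sampleOsc, Fintype.sum_sum_type, Sum.elim_inl, Sum.elim_inr, Finset.sum_const,
    Finset.card_univ, Fintype.card_fin, nsmul_eq_mul]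
  field_simp

/-- A supremum moves by at most a common bound on the changes of its terms. A point of the first
sample enters only the mean, a point of the second only the cumulant. -/
theorem abs_sampleDivergence_sub_le (H : Admissible a b f α β) (hg : ∀ k, IsTest α β (g k))
    (hn : 0 < n) (hm : 0 < m) (i : Fin n ⊕ Fin m) (z z' : Fin n ⊕ Fin m → S)
    (hz : ∀ j, j ≠ i → z j = z' j) :
    |sampleDivergence a b f α β g z - sampleDivergence a b f α β g z'|
      ≤ sampleOsc a b f α β n m i := by
  have key : ∀ z z' : Fin n ⊕ Fin m → S, (∀ j, j ≠ i → z j = z' j) →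
      sampleDivergence a b f α β g z - sampleDivergence a b f α β g z'
        ≤ sampleOsc a b f α β n m i := fun z z' hz => by
    rw [sub_le_iff_le_add]
    refine ciSup_le fun k => ?_
    have h1 := le_ciSup (bddAbove_range_of_abs_le (abs_gain_sample_le H hg hn hm z')) k
    refine le_trans ?_ (add_le_add_right h1 _)
    simp only [(hg k).gain_empiricalMeasure]
    rcases i with i | i
    · have e : (fun i => z (Sum.inr i)) = fun i => z' (Sum.inr i) :=
        funext fun j => hz _ (by simp)
      have h2 : ∑ j, g k (z (Sum.inl j)) - ∑ j, g k (z' (Sum.inl j)) ≤ β - α := by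
        rw [← Finset.sum_sub_distrib, ← Finset.add_sum_erase _ _ (Finset.mem_univ i),
          Finset.sum_eq_zero fun j hj => by
            rw [hz _ (by simpa using Finset.ne_of_mem_erase hj), sub_self], add_zero]
        linarith [((hg k).mem (z (Sum.inl i))).2, ((hg k).mem (z' (Sum.inl i))).1]
      have h3 := mul_le_mul_of_nonneg_left h2 (by positivity : (0 : ℝ) ≤ 1 / n)
      rw [e]
      simp only [sampleOsc, Sum.elim_inl]
      linarith
    · have e : ∑ j, g k (z (Sum.inl j)) = ∑ j, g k (z' (Sum.inl j)) :=
        Finset.sum_congr rfl fun j _ => by rw [hz _ (by simp)]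
      -- The cumulant enters with a minus sign, hence the exchanged samples.
      have h2 := (hg k).cumulantReal_sub_le H hm i (fun j => z' (Sum.inr j))
        (fun j => z (Sum.inr j)) fun j hj => (hz _ (by simpa using hj)).symm
      rw [e]
      simp only [sampleOsc, Sum.elim_inr]
      linarith
  rw [abs_le]
  have h1 := key z z' hz
  have h2 := key z' z fun j hj => (hz j hj).symm
  constructor <;> linarith

end Sample

/-! ### Expected deviation of the empirical cumulant. -/

section Deviation

variable {a b : EReal} {f : ℝ → ℝ} {α β : ℝ} {S : Type*} [MeasurableSpace S] {g : ℕ → S → ℝ}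

/-- The uniform deviation of the empirical means of the functions `f^*(h - ν)`. -/
noncomputable def conjDeviation (H : Admissible a b f α β) (P : Measure S) (g : ℕ → S → ℝ) {m : ℕ}
    (y : Fin m → S) : ℝ :=
  ⨆ p : ℕ × ℕ, (∫ x, conjReal a b f (g p.1 x - shiftSeq H p.2) ∂P
    - (1 / m : ℝ) * ∑ i, conjReal a b f (g p.1 (y i) - shiftSeq H p.2))

variable {P : Measure S} {m : ℕ}

theorem measurable_conjDeviation (H : Admissible a b f α β) (hg : ∀ k, IsTest α β (g k)) :
    Measurable fun y : Fin m → S => conjDeviation H P g y :=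
  Measurable.iSup fun p => ((Finset.measurable_sum _ fun i _ =>
    ((hg p.1).measurable_conjReal H _).comp (measurable_pi_apply i)).const_mul _).const_sub _

variable [IsProbabilityMeasure P]

theorem abs_conjDeviation_term_le (H : Admissible a b f α β) (hg : ∀ k, IsTest α β (g k))
    (y : Fin m → S) (p : ℕ × ℕ) :
    |∫ x, conjReal a b f (g p.1 x - shiftSeq H p.2) ∂P
      - (1 / m : ℝ) * ∑ i, conjReal a b f (g p.1 (y i) - shiftSeq H p.2)|
      ≤ conjBound a b f α β + conjBound a b f α β := by
  have hb : ∀ x, |conjReal a b f (g p.1 x - shiftSeq H p.2)| ≤ conjBound a b f α β := fun x =>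
    H.abs_conjReal_le (sub_mem_of_shift ((hg p.1).mem x) _)
  refine (abs_sub _ _).trans (add_le_add ?_ ?_)
  · simpa using norm_integral_le_of_norm_le_const (μ := P)
      (f := fun x => conjReal a b f (g p.1 x - shiftSeq H p.2)) (.of_forall hb)
  · have := abs_signed_mean_le (1 : Fin m → ℤˣ)
      (by unfold conjBound; positivity) fun i => hb (y i)
    simpa [sgn] using this

theorem abs_conjDeviation_le (H : Admissible a b f α β) (hg : ∀ k, IsTest α β (g k))
    (y : Fin m → S) :
    |conjDeviation H P g y| ≤ conjBound a b f α β + conjBound a b f α β :=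
  abs_ciSup_le fun p => abs_conjDeviation_term_le H hg y p

/-- A difference of infima is at most the supremum of the differences, and the free term `ν`
cancels. The cumulant is thus controlled by a uniform law of large numbers for the class of all
`f^*(h - ν)`. -/
theorem cumulantReal_sub_le_conjDeviation (H : Admissible a b f α β)
    (hg : ∀ k, IsTest α β (g k)) (hm : 0 < m) (y : Fin m → S) (k : ℕ) :
    cumulantReal a b f α β P (g k) - cumulantReal a b f α β (empiricalMeasure y) (g k)
      ≤ conjDeviation H P g y := by
  have := isProbabilityMeasure_empiricalMeasure hm y
  rw [sub_le_comm, (hg k).cumulantReal_eq_ciInf (P := empiricalMeasure y) H]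
  refine le_ciInf fun j => ?_
  have h1 := (hg k).cumulantReal_le (P := P) H (shiftSeq H j)
  have h2 := le_ciSup (bddAbove_range_of_abs_le
    (abs_conjDeviation_term_le (P := P) H hg y)) (k, j)
  rw [(hg k).shifted_empiricalMeasure H]
  unfold shifted at h1
  unfold conjDeviation
  linarith

/-- Constants added to the functions cancel between mean and sample mean but change the Rademacher
average. This freedom is used with `c = 0` and with `c` equal to the shift. -/
theorem integral_conjDeviation_le (H : Admissible a b f α β) (hg : ∀ k, IsTest α β (g k))
    (hm : 0 < m) (c : ℕ → ℝ) {C : ℝ} (hc : ∀ j, |c j| ≤ C) :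
    ∫ y, conjDeviation H P g y ∂(Measure.pi fun _ : Fin m => P)
      ≤ 2 * ∫ y, radMean (fun i (p : ℕ × ℕ) =>
          conjReal a b f (g p.1 (y i) - shiftSeq H p.2) + c p.2)
        ∂(Measure.pi fun _ : Fin m => P) := by
  have hmR : (m : ℝ) ≠ 0 := by exact_mod_cast hm.ne'
  have hkey := integral_ciSup_sub_mean_le P hm
    (fun (p : ℕ × ℕ) x => conjReal a b f (g p.1 x - shiftSeq H p.2) + c p.2)
    (fun p => ((hg p.1).measurable_conjReal H _).add_const _) (C := conjBound a b f α β + C)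
    (fun p x => (abs_add_le _ _).trans (add_le_add
      (H.abs_conjReal_le (sub_mem_of_shift ((hg p.1).mem x) _)) (hc _)))
  refine le_trans (le_of_eq ?_) hkey
  refine integral_congr_ae (.of_forall fun y => iSup_congr fun p => ?_)
  rw [integral_add ((hg p.1).integrable_conjReal H _) (integrable_const _),
    Finset.sum_add_distrib]
  simp only [integral_const, probReal_univ, one_smul, Finset.sum_const, Finset.card_univ,
    Fintype.card_fin, nsmul_eq_mul]
  field_simp
  ring

theorem abs_neg_shift_sub_le (ν : Shift f α β) :
    |-(ν : ℝ) - -((α + β) / 2 - zZero f)| ≤ (β - α) / 2 := by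
  rw [abs_le]
  constructor <;> linarith [ν.2.1, ν.2.2]

theorem abs_sub_shift_le {y : ℝ} (hy : y ∈ Icc α β) (ν : Shift f α β) :
    |y - ν| ≤ |zZero f - (β - α)| + |zZero f + β - α| := by
  have := sub_mem_of_shift hy ν
  exact (abs_le_max_abs_abs this.1 this.2).trans
    (max_le (by simp) (by simp))

/-- The Rademacher average of the shifted class. -/
theorem radMean_shift_le (H : Admissible a b f α β) (hg : ∀ k, IsTest α β (g k)) (hm : 0 < m)
    (y : Fin m → S) :
    radMean (fun i (p : ℕ × ℕ) => g p.1 (y i) - shiftSeq H p.2)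
      ≤ radMean (fun i k => g k (y i)) + (β - α) / (2 * √(m : ℝ)) := by
  set C := max |α| |β| + (|zZero f - (β - α)| + |zZero f + β - α|)
  have hC0 : 0 ≤ C := by positivity
  have h1 : ∀ (i : Fin m) (k : ℕ), |g k (y i)| ≤ C := fun i k =>
    ((hg k).abs_apply_le _).trans (le_add_of_nonneg_right (by positivity))
  have h2 : ∀ (i : Fin m) (p : ℕ × ℕ), |-(shiftSeq H p.2 : ℝ)| ≤ 2 * C := fun i p => by
    have e : -(shiftSeq H p.2 : ℝ) = (g p.1 (y i) - shiftSeq H p.2) - g p.1 (y i) := by ring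
    rw [e, two_mul]
    exact (abs_sub _ _).trans (add_le_add ((abs_sub_shift_le ((hg p.1).mem _) _).trans
      (le_add_of_nonneg_left (by positivity))) (h1 i p.1))
  have hadd := radMean_add_le (C := 2 * C) (by positivity)
    (v := fun i (p : ℕ × ℕ) => g p.1 (y i)) (w := fun i (p : ℕ × ℕ) => -(shiftSeq H p.2 : ℝ))
    (fun i p => (h1 i p.1).trans (by linarith)) h2
  have hfst := radMean_comp_le hC0 h1 (Prod.fst : ℕ × ℕ → ℕ)
  -- The shifts lie within `(β - α) / 2` of their midpoint.
  have hsnd := radMean_const_le hm (fun p : ℕ × ℕ => -(shiftSeq H p.2 : ℝ)) _ _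
    fun p => abs_neg_shift_sub_le (shiftSeq H p.2)
  rw [div_div] at hsnd
  simp only [sub_eq_add_neg] at hadd ⊢
  simp only [sub_eq_add_neg] at hsnd
  linarith

/-- Contraction with the Lipschitz constant `maxSlope` of `f^*`. -/
theorem radMean_conj_le (H : Admissible a b f α β) (hg : ∀ k, IsTest α β (g k)) (hm : 0 < m)
    (y : Fin m → S) :
    radMean (fun i (p : ℕ × ℕ) => conjReal a b f (g p.1 (y i) - shiftSeq H p.2))
      ≤ maxSlope a b f α β
        * (radMean (fun i k => g k (y i)) + (β - α) / (2 * √(m : ℝ))) := by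
  have hM := H.maxSlope_nonneg
  refine le_trans ?_ (mul_le_mul_of_nonneg_left (radMean_shift_le H hg hm y) hM)
  rw [← radMean_const_mul _ hM]
  refine radMean_le_of_contraction (C := max (conjBound a b f α β)
    (maxSlope a b f α β * (|zZero f - (β - α)| + |zZero f + β - α|)))
    (fun i p => le_max_of_le_left (H.abs_conjReal_le (sub_mem_of_shift ((hg p.1).mem _) _)))
    (fun i p => le_max_of_le_right ?_) fun i p q => ?_
  · rw [abs_mul, abs_of_nonneg hM]
    exact mul_le_mul_of_nonneg_left (abs_sub_shift_le ((hg p.1).mem _) _) hM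
  · rw [← mul_sub, abs_mul, abs_of_nonneg hM]
    exact H.abs_conjReal_sub_le (sub_mem_of_shift ((hg p.1).mem _) _).2
      (sub_mem_of_shift ((hg q.1).mem _) _).2

/-- Since `f^*(h - ν) + ν = h + (f^* - id)(h - ν)`, the first part is the Rademacher average of the
class, and only the second, with Lipschitz constant `(β - α) L`, is contracted. -/
theorem radMean_conj_add_shift_le (H : Admissible a b f α β) (hg : ∀ k, IsTest α β (g k))
    (hm : 0 < m) {L : ℝ≥0} (hL : LipschitzOnWith L (rightDeriv (conjReal a b f))
      (Icc (zZero f - (β - α)) (zZero f + β - α))) (y : Fin m → S) :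
    radMean (fun i (p : ℕ × ℕ) => conjReal a b f (g p.1 (y i) - shiftSeq H p.2) + shiftSeq H p.2)
      ≤ (1 + 2 * (β - α) * L) * radMean (fun i k => g k (y i))
        + (β - α) ^ 2 * L / (2 * √(m : ℝ)) := by
  have hlt := H.lt
  set D := |zZero f - (β - α)| + |zZero f + β - α|
  set M := (β - α) * (L : ℝ)
  have hM : 0 ≤ M := mul_nonneg (by linarith) L.2
  set C := max |α| |β| + (conjBound a b f α β + D)
  have hD : 0 ≤ D := by positivity
  have hcb : 0 ≤ conjBound a b f α β := by unfold conjBound; positivity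
  have hC0 : 0 ≤ C := by positivity
  have h1 : ∀ (i : Fin m) (k : ℕ), |g k (y i)| ≤ C := fun i k =>
    ((hg k).abs_apply_le _).trans (le_add_of_nonneg_right (by positivity))
  set r : Fin m → ℕ × ℕ → ℝ := fun i p =>
    conjReal a b f (g p.1 (y i) - shiftSeq H p.2) - (g p.1 (y i) - shiftSeq H p.2)
  have hr : ∀ i p, |r i p| ≤ conjBound a b f α β + D := fun i p =>
    (abs_sub _ _).trans (add_le_add (H.abs_conjReal_le (sub_mem_of_shift ((hg p.1).mem _) _))
      (abs_sub_shift_le ((hg p.1).mem _) _))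
  have hadd := radMean_add_le hC0 (v := fun i (p : ℕ × ℕ) => g p.1 (y i)) (w := r)
    (fun i p => h1 i p.1) fun i p => (hr i p).trans (le_add_of_nonneg_left (by positivity))
  have hfst := radMean_comp_le hC0 h1 (Prod.fst : ℕ × ℕ → ℕ)
  have hcontr : radMean r ≤ M * (radMean (fun i k => g k (y i)) + (β - α) / (2 * √(m : ℝ))) := by
    refine le_trans ?_ (mul_le_mul_of_nonneg_left (radMean_shift_le H hg hm y) hM)
    rw [← radMean_const_mul _ hM]
    refine radMean_le_of_contraction (C := max (conjBound a b f α β + D) (M * D))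
      (fun i p => le_max_of_le_left (hr i p)) (fun i p => le_max_of_le_right ?_) fun i p q => ?_
    · rw [abs_mul, abs_of_nonneg hM]
      exact mul_le_mul_of_nonneg_left (abs_sub_shift_le ((hg p.1).mem _) _) hM
    · rw [← mul_sub, abs_mul, abs_of_nonneg hM]
      exact H.abs_conjReal_sub_self_le hL (sub_mem_of_shift ((hg p.1).mem _) _)
        (sub_mem_of_shift ((hg q.1).mem _) _)
  have hnn := radMean_nonneg hC0 h1
  have e : (fun i (p : ℕ × ℕ) => conjReal a b f (g p.1 (y i) - shiftSeq H p.2)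
      + (shiftSeq H p.2 : ℝ)) = fun i p => g p.1 (y i) + r i p := by
    funext i p
    simp only [r]
    ring
  rw [e]
  calc _ ≤ radMean (fun i k => g k (y i))
        + M * (radMean (fun i k => g k (y i)) + (β - α) / (2 * √(m : ℝ))) := by linarith
    -- The factor `2` in the stated constant is slack: nonnegativity of the Rademacher average
    -- allows a second copy of `M * radMean` to be added.
    _ ≤ radMean (fun i k => g k (y i))
        + (M * radMean (fun i k => g k (y i)) + M * radMean (fun i k => g k (y i))
          + M * ((β - α) / (2 * √(m : ℝ)))) := by linarith [mul_nonneg hM hnn]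
    _ = _ := by simp only [M]; ring

theorem integrable_radMean_sample (hg : ∀ k, IsTest α β (g k)) :
    Integrable (fun y : Fin m → S => radMean fun i k => g k (y i))
      (Measure.pi fun _ : Fin m => P) :=
  integrable_of_abs_le
    (measurable_radMean fun i k => (hg k).measurable.comp (measurable_pi_apply i))
    fun _ => abs_radMean_le (le_max_of_le_left (abs_nonneg α)) fun _ k => (hg k).abs_apply_le _

theorem integral_conjDeviation_le_kappa (H : Admissible a b f α β) (hg : ∀ k, IsTest α β (g k))
    (hm : 0 < m) {Γ : Set (S → ℝ)}
    (hR : rademacher Γ P m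
      = ∫ y, radMean (fun i k => g k (y i)) ∂(Measure.pi fun _ : Fin m => P)) (L : ℝ≥0) :
    ∫ y, conjDeviation H P g y ∂(Measure.pi fun _ : Fin m => P)
      ≤ 2 * kappa a b f α β L Γ P m := by
  have hI : Integrable (fun y : Fin m → S => radMean fun i k => g k (y i)) _ :=
    integrable_radMean_sample (P := P) hg
  have hbound : ∀ c : ℕ → ℝ, (∃ C, ∀ j, |c j| ≤ C) → ∀ A B : ℝ, (∀ y : Fin m → S,
      radMean (fun i (p : ℕ × ℕ) => conjReal a b f (g p.1 (y i) - shiftSeq H p.2) + c p.2)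
        ≤ A * radMean (fun i k => g k (y i)) + B) →
      ∫ y, conjDeviation H P g y ∂(Measure.pi fun _ : Fin m => P)
        ≤ 2 * (A * rademacher Γ P m + B) := by
    rintro c ⟨C, hc⟩ A B hAB
    refine (integral_conjDeviation_le H hg hm c hc).trans
      (mul_le_mul_of_nonneg_left ?_ zero_le_two)
    have hb : ∀ (y : Fin m → S) i (p : ℕ × ℕ),
        |conjReal a b f (g p.1 (y i) - shiftSeq H p.2) + c p.2| ≤ conjBound a b f α β + C :=
      fun y i p => (abs_add_le _ _).trans (add_le_add
        (H.abs_conjReal_le (sub_mem_of_shift ((hg p.1).mem _) _)) (hc _))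
    have hC0 : 0 ≤ conjBound a b f α β + C :=
      add_nonneg (by unfold conjBound; positivity) ((abs_nonneg _).trans (hc 0))
    have hmeas : Measurable fun y : Fin m → S => radMean fun i (p : ℕ × ℕ) =>
        conjReal a b f (g p.1 (y i) - shiftSeq H p.2) + c p.2 :=
      measurable_radMean fun i p =>
        (((hg p.1).measurable_conjReal H _).comp (measurable_pi_apply i)).add_const _
    have hint := integrable_of_abs_le (μ := Measure.pi fun _ : Fin m => P) hmeas
      fun y => abs_radMean_le hC0 (hb y)
    have hI' : Integrable (fun y : Fin m → S => A * radMean (fun i k => g k (y i)) + B)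
        (Measure.pi fun _ : Fin m => P) := (hI.const_mul A).add (integrable_const B)
    refine (integral_mono hint hI' hAB).trans (le_of_eq ?_)
    rw [integral_add (hI.const_mul A) (integrable_const B), integral_const_mul, hR]
    simp
  have hbasic : ∫ y, conjDeviation H P g y ∂(Measure.pi fun _ : Fin m => P)
      ≤ 2 * kappaBasic a b f α β Γ P m := by
    refine (hbound (fun _ => 0) ⟨0, by simp⟩ (maxSlope a b f α β)
      (maxSlope a b f α β * ((β - α) / (2 * √(m : ℝ)))) fun y => ?_).trans (le_of_eq ?_)
    · simpa [mul_add] using radMean_conj_le H hg hm y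
    · unfold kappaBasic
      ring
  unfold kappa
  split_ifs with hcond
  · rw [mul_min_of_nonneg _ _ zero_le_two]
    refine le_min (hbound (fun j => shiftSeq H j)
      ⟨max |α - zZero f| |β - zZero f|, fun j =>
        abs_le_max_abs_abs (shiftSeq H j).2.1 (shiftSeq H j).2.2⟩ _ _
      fun y => radMean_conj_add_shift_le H hg hm hcond.1 y) hbasic
  · exact hbasic

end Deviation

/-! ### The bias of the empirical divergence. -/

section Main

variable {a b : EReal} {f : ℝ → ℝ} {α β : ℝ} {S : Type*} [MeasurableSpace S] {g : ℕ → S → ℝ}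
  {Q P : Measure S} {Ω : Type*} [MeasurableSpace Ω] {μ : Measure Ω} [IsProbabilityMeasure μ]
  {n m : ℕ}

theorem integral_sample_mean {X : Fin n → Ω → S} (hn : 0 < n) (hX : ∀ i, Measurable (X i))
    (hXlaw : ∀ i, μ.map (X i) = Q) {u : S → ℝ} (hu : Measurable u) {C : ℝ} (hC : ∀ x, |u x| ≤ C) :
    ∫ ω, (1 / n : ℝ) * ∑ i, u (X i ω) ∂μ = ∫ x, u x ∂Q := by
  have hi : ∀ i, Integrable (fun ω => u (X i ω)) μ := fun i =>
    integrable_of_abs_le (hu.comp (hX i)) fun ω => hC _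
  rw [integral_const_mul, integral_finsetSum _ fun i _ => hi i]
  have : ∀ i, ∫ ω, u (X i ω) ∂μ = ∫ x, u x ∂Q := fun i => by
    rw [← hXlaw i, integral_map (hX i).aemeasurable hu.aestronglyMeasurable]
  simp [this, hn.ne']

theorem integrable_sampleDivergence (H : Admissible a b f α β) (hg : ∀ k, IsTest α β (g k))
    (hn : 0 < n) (hm : 0 < m) {Z : Fin n ⊕ Fin m → Ω → S} (hZ : ∀ i, Measurable (Z i)) :
    Integrable (fun ω => sampleDivergence a b f α β g fun i => Z i ω) μ := by
  have hZ' : Measurable fun ω i => Z i ω := measurable_pi_lambda _ hZ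
  have hD := measurable_sampleDivergence (n := n) H hg hm
  have hb := abs_sampleDivergence_le H hg hn hm
  generalize sampleDivergence (n := n) (m := m) a b f α β g = F at hD hb ⊢
  exact integrable_of_abs_le (F := fun ω => F fun i => Z i ω) (hD.comp hZ') fun ω => hb _

/-- The empirical divergence overestimates the divergence in the mean. -/
theorem ciSup_gain_le_integral (H : Admissible a b f α β) (hg : ∀ k, IsTest α β (g k))
    (hn : 0 < n) (hm : 0 < m) {X : Fin n → Ω → S} {X' : Fin m → Ω → S}
    (hX : ∀ i, Measurable (X i)) (hX' : ∀ i, Measurable (X' i))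
    (hXlaw : ∀ i, μ.map (X i) = Q) (hX'law : ∀ i, μ.map (X' i) = P) :
    ⨆ k, gain a b f α β Q P (g k)
      ≤ ∫ ω, sampleDivergence a b f α β g (fun i => Sum.elim X X' i ω) ∂μ := by
  have hZ : ∀ i, Measurable (Sum.elim X X' i) := fun i => by
    rcases i with i | i
    exacts [hX i, hX' i]
  refine ciSup_le fun k => ?_
  have hc : Measurable fun ω =>
      cumulantReal a b f α β (empiricalMeasure fun i => X' i ω) (g k) :=
    ((hg k).measurable_cumulantReal H hm).comp (measurable_pi_lambda _ hX')
  have hci : Integrable (fun ω =>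
      cumulantReal a b f α β (empiricalMeasure fun i => X' i ω) (g k)) μ :=
    integrable_of_abs_le hc (C := max |α| |β|) fun ω => by
      have := isProbabilityMeasure_empiricalMeasure hm fun i => X' i ω
      have h1 := (hg k).cumulantReal_mem (P := empiricalMeasure fun i => X' i ω) H
      exact abs_le_max_abs_abs h1.1 h1.2
  have hmi : Integrable (fun ω => (1 / n : ℝ) * ∑ i, g k (X i ω)) μ :=
    (integrable_finsetSum _ fun i _ => integrable_of_abs_le ((hg k).measurable.comp (hX i))
      fun ω => (hg k).abs_apply_le _).const_mul _
  have h1 : ∫ ω, cumulantReal a b f α β (empiricalMeasure fun i => X' i ω) (g k) ∂μ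
      ≤ cumulantReal a b f α β P (g k) := by
    have := H.nonempty_shift
    refine le_ciInf fun ν => ?_
    have hb : ∀ x, |conjReal a b f (g k x - ν)| ≤ conjBound a b f α β := fun x =>
      H.abs_conjReal_le (sub_mem_of_shift ((hg k).mem x) ν)
    have hi : Integrable (fun ω => (1 / m : ℝ) * ∑ i, conjReal a b f (g k (X' i ω) - ν)) μ :=
      (integrable_finsetSum _ fun i _ => integrable_of_abs_le
        (((hg k).measurable_conjReal H ν).comp (hX' i)) fun ω => hb _).const_mul _
    -- The expectation of the infimum is at most the expectation at each fixed shift, which is the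
    -- objective under `P`.
    calc _ ≤ ∫ ω, ((ν : ℝ) + (1 / m : ℝ) * ∑ i, conjReal a b f (g k (X' i ω) - ν)) ∂μ := by
          refine integral_mono hci ((integrable_const _).add hi) fun ω => ?_
          have := isProbabilityMeasure_empiricalMeasure hm fun i => X' i ω
          exact ((hg k).cumulantReal_le H ν).trans ((hg k).shifted_empiricalMeasure H ν _).le
      _ = _ := by
          rw [integral_add (integrable_const _) hi,
            integral_sample_mean hm hX' hX'law ((hg k).measurable_conjReal H ν) hb]
          simp [shifted]
  calc gain a b f α β Q P (g k)
      ≤ ∫ ω, ((1 / n : ℝ) * ∑ i, g k (X i ω)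
        - cumulantReal a b f α β (empiricalMeasure fun i => X' i ω) (g k)) ∂μ := by
        rw [integral_sub hmi hci,
          integral_sample_mean hn hX hXlaw (hg k).measurable (hg k).abs_apply_le]
        unfold gain
        linarith
    _ ≤ _ := by
        refine integral_mono (hmi.sub hci) (integrable_sampleDivergence H hg hn hm hZ)
          fun ω => ?_
        refine le_trans (le_of_eq ?_) (le_ciSup (bddAbove_range_of_abs_le
          (abs_gain_sample_le H hg hn hm fun i => Sum.elim X X' i ω)) k)
        rw [(hg k).gain_empiricalMeasure]
        rfl

variable [IsProbabilityMeasure Q] [IsProbabilityMeasure P]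

/-- The bias of the empirical divergence is controlled by the Rademacher complexities. -/
theorem integral_sampleDivergence_le (H : Admissible a b f α β) (hg : ∀ k, IsTest α β (g k))
    (hn : 0 < n) (hm : 0 < m) {X : Fin n → Ω → S} {X' : Fin m → Ω → S}
    (hX : ∀ i, Measurable (X i)) (hX' : ∀ i, Measurable (X' i))
    (hXpi : μ.map (fun ω i => X i ω) = Measure.pi fun _ => Q)
    (hX'pi : μ.map (fun ω i => X' i ω) = Measure.pi fun _ => P) {Γ : Set (S → ℝ)}
    (hRQ : rademacher Γ Q n
      = ∫ y, radMean (fun i k => g k (y i)) ∂(Measure.pi fun _ : Fin n => Q))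
    (hRP : rademacher Γ P m
      = ∫ y, radMean (fun i k => g k (y i)) ∂(Measure.pi fun _ : Fin m => P)) (L : ℝ≥0) :
    ∫ ω, sampleDivergence a b f α β g (fun i => Sum.elim X X' i ω) ∂μ
      ≤ (⨆ k, gain a b f α β Q P (g k)) + 2 * rademacher Γ Q n
        + 2 * kappa a b f α β L Γ P m := by
  have hZ : ∀ i, Measurable (Sum.elim X X' i) := fun i => by
    rcases i with i | i
    exacts [hX i, hX' i]
  have hXm : Measurable fun ω i => X i ω := measurable_pi_lambda _ hX
  have hX'm : Measurable fun ω i => X' i ω := measurable_pi_lambda _ hX'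
  set U : (Fin n → S) → ℝ := fun y => ⨆ k, ((1 / n : ℝ) * ∑ i, g k (y i) - ∫ x, g k x ∂Q)
  have hUt : ∀ y : Fin n → S, ∀ k, |(1 / n : ℝ) * ∑ i, g k (y i) - ∫ x, g k x ∂Q|
      ≤ max |α| |β| + max |α| |β| := fun y k => by
    refine (abs_sub _ _).trans (add_le_add ?_ ?_)
    · have := abs_signed_mean_le (1 : Fin n → ℤˣ) (le_max_of_le_left (abs_nonneg α))
        fun i => (hg k).abs_apply_le (y i)
      simpa [sgn] using this
    · have := (hg k).integral_mem (P := Q)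
      exact abs_le_max_abs_abs this.1 this.2
  have hUm : Measurable U := Measurable.iSup fun k => ((Finset.measurable_sum _ fun i _ =>
    (hg k).measurable.comp (measurable_pi_apply i)).const_mul _).sub_const _
  have hUi : Integrable (fun ω => U fun i => X i ω) μ :=
    integrable_of_abs_le (hUm.comp hXm) fun ω => abs_ciSup_le (hUt _)
  have hVm : Measurable fun y : Fin m → S => conjDeviation H P g y :=
    measurable_conjDeviation H hg
  have hVi : Integrable (fun ω => conjDeviation H P g fun i => X' i ω) μ :=
    integrable_of_abs_le (hVm.comp hX'm) fun ω => abs_conjDeviation_le H hg _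
  have hU : ∫ ω, U (fun i => X i ω) ∂μ ≤ 2 * rademacher Γ Q n := by
    rw [← integral_map (f := U) hXm.aemeasurable hUm.aestronglyMeasurable, hXpi, hRQ]
    exact integral_ciSup_mean_sub_le Q hn g (fun k => (hg k).measurable)
      fun k => (hg k).abs_apply_le
  have hV : ∫ ω, conjDeviation H P g (fun i => X' i ω) ∂μ ≤ 2 * kappa a b f α β L Γ P m := by
    rw [← integral_map (f := fun y => conjDeviation H P g y) hX'm.aemeasurable
      hVm.aestronglyMeasurable, hX'pi]
    exact integral_conjDeviation_le_kappa H hg hm hRP L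
  set D := ⨆ k, gain a b f α β Q P (g k)
  -- For each test function, the empirical gain is the true gain plus the deviation of the mean plus
  -- the deviation of the cumulant; each is bounded by its supremum.
  have hle : ∀ ω, sampleDivergence a b f α β g (fun i => Sum.elim X X' i ω)
      ≤ D + U (fun i => X i ω) + conjDeviation H P g fun i => X' i ω := fun ω => by
    refine ciSup_le fun k => ?_
    rw [(hg k).gain_empiricalMeasure]
    have h1 : gain a b f α β Q P (g k) ≤ D :=
      le_ciSup (bddAbove_range_of_abs_le fun k => (hg k).abs_gain_le (Q := Q) (P := P) H) k
    have h2 := le_ciSup (bddAbove_range_of_abs_le (hUt fun i => X i ω)) k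
    have h3 := cumulantReal_sub_le_conjDeviation (P := P) H hg hm (fun i => X' i ω) k
    change (1 / n : ℝ) * ∑ i, g k (X i ω)
      - cumulantReal a b f α β (empiricalMeasure fun i => X' i ω) (g k) ≤ _
    unfold gain at h1
    simp only [U]
    linarith
  have hDU : Integrable (fun ω => D + U fun i => X i ω) μ := (integrable_const _).add hUi
  calc _ ≤ ∫ ω, (D + U (fun i => X i ω) + conjDeviation H P g fun i => X' i ω) ∂μ :=
        integral_mono (integrable_sampleDivergence H hg hn hm hZ)
          (hDU.add hVi) hle
    _ ≤ _ := by
        rw [integral_add hDU hVi, integral_add (integrable_const _) hUi]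
        simp only [integral_const, probReal_univ, one_smul]
        linarith

end Main

end FGamma

/-! ### The two tail bounds. -/

theorem mainTheorem5
    {S : Type*} [MeasurableSpace S]
    -- the convex function `f : (a, b) → ℝ`
    (a b : EReal) (f : ℝ → ℝ) (hf : FGamma.IsF1 a b f) (ha : 0 ≤ a)
    (hstrict : ∃ U ∈ 𝓝 (1 : ℝ), StrictConvexOn ℝ U f)
    (α β : ℝ) (hαβ : α < β)
    (hz : FGamma.zZero f + β - α ∈ interior (FGamma.conjDomain a b f))
    -- the function class
    (Γ : Set (S → ℝ)) (hne : Γ.Nonempty) (hmeas : ∀ h ∈ Γ, Measurable h)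
    (hbdd : ∀ h ∈ Γ, ∀ x, α ≤ h x ∧ h x ≤ β)
    (hcount : ∃ Γ₀ ⊆ Γ, Γ₀.Countable ∧ ∀ h ∈ Γ, ∃ u : ℕ → S → ℝ,
      (∀ j, u j ∈ Γ₀) ∧ ∀ x, Tendsto (fun j => u j x) atTop (𝓝 (h x)))
    -- the two distributions and the samples
    (Q P : Measure S) [IsProbabilityMeasure Q] [IsProbabilityMeasure P]
    {Ω : Type*} [MeasurableSpace Ω] (μ : Measure Ω) [IsProbabilityMeasure μ]
    (n m : ℕ) (hn : 0 < n) (hm : 0 < m)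
    (X : Fin n → Ω → S) (X' : Fin m → Ω → S)
    (hX : ∀ i, Measurable (X i)) (hX' : ∀ i, Measurable (X' i))
    (hXlaw : ∀ i, μ.map (X i) = Q) (hX'law : ∀ i, μ.map (X' i) = P)
    (hindep : iIndepFun (fun k : Fin n ⊕ Fin m => Sum.elim X X' k) μ)
    (ε : ℝ) (hε : 0 < ε) :
    μ.real {ω | (ε : EReal) ≤ FGamma.divergence a b f Γ Q P
          - FGamma.divergence a b f Γ (FGamma.empiricalMeasure (fun i => X i ω))
              (FGamma.empiricalMeasure (fun i => X' i ω))}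
        ≤ Real.exp (-(2 * ε ^ 2
            / (1 / n * (β - α) ^ 2 + 1 / m * FGamma.delta a b f α β m ^ 2)))
    ∧ ∀ L : ℝ≥0,
      μ.real {ω | ((ε + 2 * FGamma.rademacher Γ Q n
              + 2 * FGamma.kappa a b f α β L Γ P m : ℝ) : EReal)
            ≤ FGamma.divergence a b f Γ (FGamma.empiricalMeasure (fun i => X i ω))
                (FGamma.empiricalMeasure (fun i => X' i ω))
              - FGamma.divergence a b f Γ Q P}
        ≤ Real.exp (-(2 * ε ^ 2
            / (1 / n * (β - α) ^ 2 + 1 / m * FGamma.delta a b f α β m ^ 2))) := by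
  have H : FGamma.Admissible a b f α β := ⟨hf, ha, hαβ, hz⟩
  have hΓ : ∀ h ∈ Γ, FGamma.IsTest α β h := fun h hh => ⟨hmeas h hh, hbdd h hh⟩
  obtain ⟨Γ₀, hsub, hΓ₀, hdense⟩ := hcount
  have hne₀ : Γ₀.Nonempty := by
    obtain ⟨h, hh⟩ := hne
    obtain ⟨u, hu, -⟩ := hdense h hh
    exact ⟨u 0, hu 0⟩
  obtain ⟨g, rfl⟩ := hΓ₀.exists_eq_range hne₀
  have hgΓ : ∀ k, g k ∈ Γ := fun k => hsub ⟨k, rfl⟩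
  have hg : ∀ k, FGamma.IsTest α β (g k) := fun k => hΓ _ (hgΓ k)
  have hZm : ∀ i, Measurable (Sum.elim X X' i) := fun i => by
    rcases i with i | i
    exacts [hX i, hX' i]
  set D := ⨆ k, FGamma.gain a b f α β Q P (g k)
  set Dr : Ω → ℝ := fun ω =>
    FGamma.sampleDivergence a b f α β g (fun i => Sum.elim X X' i ω)
  have hD : FGamma.divergence a b f Γ Q P = (D : EReal) :=
    FGamma.divergence_eq H hΓ hgΓ hdense
  have hDr : ∀ ω, FGamma.divergence a b f Γ (FGamma.empiricalMeasure fun i => X i ω)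
      (FGamma.empiricalMeasure fun i => X' i ω) = (Dr ω : EReal) := fun ω => by
    have := FGamma.isProbabilityMeasure_empiricalMeasure hn fun i => X i ω
    have := FGamma.isProbabilityMeasure_empiricalMeasure hm fun i => X' i ω
    exact FGamma.divergence_eq H hΓ hgΓ hdense
  have hpos : 0 < ∑ i, FGamma.sampleOsc a b f α β n m i ^ 2 := by
    rw [FGamma.sum_sampleOsc_sq hn hm]
    have h1 : 0 < β - α := sub_pos.2 hαβ
    have h2 : (0 : ℝ) < n := by exact_mod_cast hn
    positivity
  have hFm := FGamma.measurable_sampleDivergence (n := n) H hg hm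
  have hFb := FGamma.abs_sampleDivergence_le H hg hn hm
  have hFd := FGamma.abs_sampleDivergence_sub_le H hg hn hm
  rw [← FGamma.sum_sampleOsc_sq hn hm]
  refine ⟨?_, fun L => ?_⟩
  · have hmc := FGamma.measureReal_ge_le_of_bounded_difference μ (Sum.elim X X') hZm hindep
      (fun z => -FGamma.sampleDivergence a b f α β g z) hFm.neg (β - α)
      (fun z => (abs_neg _).le.trans (hFb z)) _
      (fun i x y hxy => by rw [← neg_sub', abs_neg]; exact hFd i x y hxy) hpos ε hε
    refine le_trans (measureReal_mono fun ω hω => ?_) hmc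
    -- The true divergence is at most the mean of the empirical one, so the event lies in the
    -- lower-tail event around that mean.
    have h1 := FGamma.ciSup_gain_le_integral H hg hn hm hX hX' hXlaw hX'law
    simp only [mem_ofPred_eq, hD, hDr, ← EReal.coe_sub, EReal.coe_le_coe_iff, integral_neg] at hω ⊢
    linarith
  · have hmc := FGamma.measureReal_ge_le_of_bounded_difference μ (Sum.elim X X') hZm hindep
      (fun z => FGamma.sampleDivergence a b f α β g z) hFm (β - α) hFb _ hFd hpos ε hε
    refine le_trans (measureReal_mono fun ω hω => ?_) hmc
    have hXpi : μ.map (fun ω i => X i ω) = Measure.pi fun _ => Q := by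
      have := (iIndepFun_iff_map_fun_eq_pi_map fun i => (hX i).aemeasurable).1
        (iIndepFun.precomp (g := Sum.inl) Sum.inl_injective hindep)
      simpa only [hXlaw] using this
    have hX'pi : μ.map (fun ω i => X' i ω) = Measure.pi fun _ => P := by
      have := (iIndepFun_iff_map_fun_eq_pi_map fun i => (hX' i).aemeasurable).1
        (iIndepFun.precomp (g := Sum.inr) Sum.inr_injective hindep)
      simpa only [hX'law] using this
    have hR : ∀ (k : ℕ) (ρ : Measure S), FGamma.rademacher Γ ρ k
        = ∫ y, FGamma.radMean (fun i j => g j (y i)) ∂(Measure.pi fun _ : Fin k => ρ) :=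
      fun k ρ => integral_congr_ae (.of_forall fun y => FGamma.empRademacher_eq hΓ hgΓ hdense y)
    -- The mean exceeds the true divergence by at most the two complexity terms in the threshold,
    -- which leaves a deviation of at least `ε` above the mean.
    have h1 := FGamma.integral_sampleDivergence_le H hg hn hm hX hX' hXpi hX'pi (hR n Q) (hR m P) L
    simp only [mem_ofPred_eq, hD, hDr, ← EReal.coe_sub, EReal.coe_le_coe_iff] at hω ⊢
    linarith
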